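/- Let $K$ be a finite field with $q$ elements and $\operatorname{char} K\neq 2$. Let $UJ_2$ be the Jordan algebra of upper triangular $2\times 2$ matrices over $K$ with product $u\circ v=\tfrac12(uv+vu)$, with the associative $\mathbb Z_2$-grading $(UJ_2)_0=\operatorname{span}\{e_{11}+e_{22},\,e_{12}\}$, $(UJ_2)_1=\operatorname{span}\{e_{11}-e_{22}\}$. Let $J(X)$ be the free (unital) Jordan algebra over $K$ freely generated by $X=\{y_1,y_2,\dots\}\cup\{z_1,z_2,\dots\}$, $\mathbb Z_2$-graded so that the $y_i$ are even and the $z_i$ are odd. A $T_{\mathbb Z_2}$-ideal of $J(X)$ is an ideal closed under all graded endomorphisms, and $T_{\mathrm{Ass}}(UJ_2)$ is the set of all $f\in J(X)$ that vanish under every substitution of elements of $(UJ_2)_0$ for the $y_i$ and of elements of $(UJ_2)_1$ for the $z_i$. Write $(u,v,w)=(uv)w-u(vw)$, and let products and powers without parentheses be left-normed, $f_1f_2\cdots f_n=(f_1\cdots f_{n-1})f_n$, the empty product being $1$. Let $I'$ be the $T_{\mathbb Z_2}$-ideal of $J(X)$ generated by $$(y_1,y_2,y_3),\quad (z_1,y_1,y_2),\quad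 (z_1,y_1,z_2),\quad (z_1,z_2,z_3),\quad (z_1z_2,z_3,z_4),$$ $$(y_1^q-y_1)(y_2^q-y_2),\quad z_1^q-z_1,\quad (y_1^q-y_1)z_1 .$$ Then $I'=T_{\mathrm{Ass}}(UJ_2)$. Moreover, the cosets modulo $I'$ of the following polynomials are pairwise distinct (for distinct exponent sequences and indices) and form a basis of the vector space $J(X)/I'$; here $k=(k_1,k_2,\dots)$ and $t=(t_1,t_2,\dots)$ are sequences of non-negative integers with finitely many nonzero terms, $y^k=y_1^{k_1}y_2^{k_2}\cdots$, $z^t=z_1^{t_1}z_2^{t_2}\cdots$ and $|t|=\sum_m t_m$: (a) $y^k$, where all $k_m<2q$ and at most one $k_m$ is $\ge q$; (b) $y^k z^t$, where all $k_m<q$, all $t_m<q$, and $|t|>0$ is even; (c) $(y^k z_j)z^t$, where $j\ge 1$, all $k_m<q$, $t_m=0$ for $m<j$, $t_j<q-1$, $t_m<q$ for $m>j$, and $|t|$ is even; (d) $(((y_iz_j)z_l)y^k)z^t$, where $i\ge 1$, $1\le j\le l$, all $k_m<q$, $t_m=0$ for $m<l$, $t_m<q$ for $m>l$, $|t|$ is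 even, and $t_l<q-1$ if $j<l$, $t_l<q-2$ if $j=l$. -/

import Mathlib

noncomputable section

namespace GradedUJ

/-! ### The free Jordan algebra `J(X)` -/

/-- The set `X = Y ∪ Z` of free generators, `Y = {y 0, y 1, …}` and `Z = {z 0, z 1, …}`. -/
inductive Var : Type
  | y (i : ℕ)
  | z (i : ℕ)

/-- The free unital nonassociative algebra on `X` over `K`: as a vector space it has as basis the
free magma on `X` with a unit adjoined. -/
abbrev FreeNonassoc (K : Type*) [Field K] := MonoidAlgebra K (WithOne (FreeMagma Var))

/-- The defining identities of Jordan algebras: commutativity and `(ab)(aa) = a(b(aa))`. -/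
inductive JordanRel (K : Type*) [Field K] : FreeNonassoc K → FreeNonassoc K → Prop
  | comm (a b : FreeNonassoc K) : JordanRel K (a * b) (b * a)
  | jordan (a b : FreeNonassoc K) : JordanRel K (a * b * (a * a)) (a * (b * (a * a)))

/-- `J(X)`: the free (unital) Jordan algebra over `K`, freely generated by `X`. It is the
quotient of the free unital nonassociative algebra by the congruence generated by all instances
of the Jordan identities. Its universal property is `J.lift`, `J.hom_ext`. -/
def J (K : Type*) [Field K] : Type _ := (ringConGen (JordanRel K)).Quotient

instance (K : Type*) [Field K] : NonAssocCommRing (J K) :=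
  { (inferInstance : NonAssocRing (ringConGen (JordanRel K)).Quotient) with
    mul_comm := by
      rintro ⟨a⟩ ⟨b⟩
      exact (RingCon.eq _).2 (RingConGen.Rel.of _ _ (.comm a b)) }

instance (K : Type*) [Field K] : Module K (J K) :=
  { (inferInstance : DistribMulAction K (ringConGen (JordanRel K)).Quotient) with
    add_smul := by
      rintro c d ⟨a⟩
      exact congrArg (RingCon.toQuotient (c := ringConGen (JordanRel K))) (add_smul c d a)
    zero_smul := by
      rintro ⟨a⟩
      exact congrArg (RingCon.toQuotient (c := ringConGen (JordanRel K))) (zero_smul K a) }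

instance (K : Type*) [Field K] : IsScalarTower K (J K) (J K) where
  smul_assoc := by
    rintro c ⟨a⟩ ⟨b⟩
    exact congrArg (RingCon.toQuotient (c := ringConGen (JordanRel K))) (smul_mul_assoc c a b)

instance (K : Type*) [Field K] : SMulCommClass K (J K) (J K) where
  smul_comm := by
    rintro c ⟨a⟩ ⟨b⟩
    exact congrArg (RingCon.toQuotient (c := ringConGen (JordanRel K)))
      (mul_smul_comm c a b).symm

instance (K : Type*) [Field K] : IsCommJordan (J K) where
  lmul_comm_rmul_rmul := by
    rintro ⟨a⟩ ⟨b⟩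
    exact (RingCon.eq _).2 (RingConGen.Rel.of _ _ (.jordan a b))

/-- The projection of the free unital nonassociative algebra onto `J(X)`. -/
def J.mk (K : Type*) [Field K] : FreeNonassoc K →ₙₐ[K] J K where
  toFun a := RingCon.toQuotient (c := ringConGen (JordanRel K)) a
  map_smul' _ _ := rfl
  map_zero' := rfl
  map_add' _ _ := rfl
  map_mul' _ _ := rfl

theorem J.mk_surjective (K : Type*) [Field K] : Function.Surjective (J.mk K) := by
  rintro ⟨a⟩
  exact ⟨a, rfl⟩

theorem J.mk_one (K : Type*) [Field K] : J.mk K 1 = 1 := rfl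

/-- The free generators of `J(X)`. -/
def J.var (K : Type*) [Field K] (v : Var) : J K :=
  J.mk K (MonoidAlgebra.single ((FreeMagma.of v : FreeMagma Var) : WithOne (FreeMagma Var)) 1)

/-- The even variable `y_i`. -/
def y (K : Type*) [Field K] (i : ℕ) : J K := J.var K (.y i)

/-- The odd variable `z_i`. -/
def z (K : Type*) [Field K] (i : ℕ) : J K := J.var K (.z i)

section Lift

variable {K : Type*} [Field K] {A : Type*} [NonAssocCommRing A] [IsCommJordan A] [Module K A]
  [IsScalarTower K A A] [SMulCommClass K A A]

/-- Evaluation of nonassociative polynomials at elements of `A`. -/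
def freeLift (v : Var → A) : FreeNonassoc K →ₙₐ[K] A :=
  MonoidAlgebra.liftMagma K (WithOne.lift (FreeMagma.lift v)).toMulHom

theorem freeLift_single (v : Var → A) (m : WithOne (FreeMagma Var)) :
    freeLift (K := K) v (MonoidAlgebra.single m 1) = WithOne.lift (FreeMagma.lift v) m := by
  simp [freeLift]

theorem freeLift_congr (v : Var → A) {a b : FreeNonassoc K} (h : ringConGen (JordanRel K) a b) :
    freeLift v a = freeLift v b := by
  induction h with
  | of a b h =>
    cases h with
    | comm a b => rw [map_mul, map_mul, mul_comm]
    | jordan a b =>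
      simp only [map_mul]
      exact IsCommJordan.lmul_comm_rmul_rmul _ _
  | refl => rfl
  | symm _ ih => exact ih.symm
  | trans _ _ ih₁ ih₂ => exact ih₁.trans ih₂
  | add _ _ ih₁ ih₂ => rw [map_add, map_add, ih₁, ih₂]
  | mul _ _ ih₁ ih₂ => rw [map_mul, map_mul, ih₁, ih₂]

/-- Evaluation of the elements of `J(X)` in a unital Jordan algebra `A`: `J.lift v f` is the
result of substituting `v x` for every variable `x` of `f`. -/
def J.lift (v : Var → A) : J K →ₙₐ[K] A where
  toFun f := Quotient.liftOn' f (freeLift v) fun _ _ h => freeLift_congr v h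
  map_smul' c := by
    rintro ⟨a⟩
    exact map_smul (freeLift v) c a
  map_zero' := map_zero (freeLift (K := K) v)
  map_add' := by
    rintro ⟨a⟩ ⟨b⟩
    exact map_add (freeLift v) a b
  map_mul' := by
    rintro ⟨a⟩ ⟨b⟩
    exact map_mul (freeLift v) a b

theorem J.lift_mk (v : Var → A) (a : FreeNonassoc K) : J.lift v (J.mk K a) = freeLift v a := rfl

theorem J.lift_one (v : Var → A) : J.lift (K := K) v 1 = 1 := by
  rw [← J.mk_one, J.lift_mk, MonoidAlgebra.one_def, freeLift_single, map_one]

theorem J.lift_var (v : Var → A) (x : Var) : J.lift v (J.var K x) = v x := by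
  rw [J.var, J.lift_mk, freeLift_single, WithOne.lift_coe, FreeMagma.lift_of]

theorem J.hom_ext {φ ψ : J K →ₙₐ[K] A} (h₁ : φ 1 = ψ 1)
    (h : ∀ x, φ (J.var K x) = ψ (J.var K x)) : φ = ψ := by
  have key : φ.comp (J.mk K) = ψ.comp (J.mk K) := by
    refine MonoidAlgebra.nonUnitalAlgHom_ext K fun m => ?_
    cases m with
    | one => exact h₁
    | coe m =>
      induction m using FreeMagma.rec with
      | of x => exact h x
      | mul a b iha ihb =>
        have : (MonoidAlgebra.single ((a * b : FreeMagma Var) : WithOne (FreeMagma Var)) 1 :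
            FreeNonassoc K) = MonoidAlgebra.single (a : WithOne (FreeMagma Var)) 1 *
              MonoidAlgebra.single (b : WithOne (FreeMagma Var)) 1 := by
          rw [MonoidAlgebra.single_mul_single, mul_one, WithOne.coe_mul]
        change φ.comp (J.mk K) (MonoidAlgebra.single _ 1) = 
          ψ.comp (J.mk K) (MonoidAlgebra.single _ 1)
        erw [this, map_mul, map_mul, iha, ihb]
  ext f
  obtain ⟨a, rfl⟩ := J.mk_surjective K f
  exact DFunLike.congr_fun key a

end Lift

/-! ### The grading of `J(X)` and `T_{ℤ₂}`-ideals -/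

/-- `IsMonomial K i u` says that `u` is a monomial of `J(X)` of homogeneous degree `i`, where
the `y`'s have degree `0`, the `z`'s have degree `1`, and degrees add under products. -/
inductive IsMonomial (K : Type*) [Field K] : ZMod 2 → J K → Prop
  | one : IsMonomial K 0 1
  | y (i : ℕ) : IsMonomial K 0 (y K i)
  | z (i : ℕ) : IsMonomial K 1 (z K i)
  | mul {i j : ZMod 2} {u v : J K} (hu : IsMonomial K i u) (hv : IsMonomial K j v) :
      IsMonomial K (i + j) (u * v)

/-- The homogeneous components `J(X)₀` and `J(X)₁`. -/
def J.component (K : Type*) [Field K] (i : ZMod 2) : Submodule K (J K) :=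
  Submodule.span K {u | IsMonomial K i u}

/-- `φ` is an endomorphism of the `ℤ₂`-graded unital algebra `J(X)`. -/
def IsGradedEnd {K : Type*} [Field K] (φ : J K →ₙₐ[K] J K) : Prop :=
  φ 1 = 1 ∧ ∀ i, ∀ f ∈ J.component K i, φ f ∈ J.component K i

/-- A `T_{ℤ₂}`-ideal of `J(X)`: an ideal closed under all graded endomorphisms. -/
structure IsTIdeal {K : Type*} [Field K] (I : Submodule K (J K)) : Prop where
  mul_left : ∀ g f : J K, f ∈ I → g * f ∈ I
  mul_right : ∀ g f : J K, f ∈ I → f * g ∈ I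
  map_mem : ∀ φ : J K →ₙₐ[K] J K, IsGradedEnd φ → ∀ f ∈ I, φ f ∈ I

/-- The `T_{ℤ₂}`-ideal of `J(X)` generated by `W`: the least one containing `W`. -/
def tIdeal {K : Type*} [Field K] (W : Set (J K)) : Submodule K (J K) :=
  sInf {I | IsTIdeal I ∧ W ⊆ I}

theorem subset_tIdeal {K : Type*} [Field K] (W : Set (J K)) : W ⊆ tIdeal W := fun _ hf =>
  Submodule.mem_sInf.2 fun _ hI => hI.2 hf

theorem isTIdeal_tIdeal {K : Type*} [Field K] (W : Set (J K)) : IsTIdeal (tIdeal W) where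
  mul_left g f hf := Submodule.mem_sInf.2 fun I hI =>
    hI.1.mul_left g f (Submodule.mem_sInf.1 hf I hI)
  mul_right g f hf := Submodule.mem_sInf.2 fun I hI =>
    hI.1.mul_right g f (Submodule.mem_sInf.1 hf I hI)
  map_mem φ hφ f hf := Submodule.mem_sInf.2 fun I hI =>
    hI.1.map_mem φ hφ f (Submodule.mem_sInf.1 hf I hI)

/-! ### The Jordan algebra `UJ₂` with the associative grading -/

/-- The associative algebra of upper triangular `2 × 2` matrices. -/
def UT2 (K : Type*) [Field K] : Subalgebra K (Matrix (Fin 2) (Fin 2) K) where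
  carrier := {M | M 1 0 = 0}
  mul_mem' {a b} ha hb := by
    simp only [Set.mem_ofPred_eq] at *
    simp [Matrix.mul_apply, Fin.sum_univ_two, ha, hb]
  add_mem' {a b} ha hb := by
    simp only [Set.mem_ofPred_eq] at *
    simp [ha, hb]
  algebraMap_mem' r := by simp [Matrix.algebraMap_matrix_apply]

/-- The matrix unit `e₁₁`. -/
def e11 (K : Type*) [Field K] : UT2 K := ⟨!![1, 0; 0, 0], by simp [UT2, ← SetLike.mem_coe]⟩

/-- The matrix unit `e₂₂`. -/
def e22 (K : Type*) [Field K] : UT2 K := ⟨!![0, 0; 0, 1], by simp [UT2, ← SetLike.mem_coe]⟩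

/-- The matrix unit `e₁₂`. -/
def e12 (K : Type*) [Field K] : UT2 K := ⟨!![0, 1; 0, 0], by simp [UT2, ← SetLike.mem_coe]⟩

instance (K : Type*) [Field K] [NeZero (2 : K)] : Invertible (2 : UT2 K) where
  invOf := algebraMap K (UT2 K) 2⁻¹
  invOf_mul_self := by
    rw [← map_ofNat (algebraMap K (UT2 K)) 2, ← map_mul, inv_mul_cancel₀ (NeZero.ne _), map_one]
  mul_invOf_self := by
    rw [← map_ofNat (algebraMap K (UT2 K)) 2, ← map_mul, mul_inv_cancel₀ (NeZero.ne _), map_one]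

/-- `UJ₂`: the vector space `UT₂` with the product `u ∘ v = (1/2)(uv + vu)`. -/
abbrev UJ2 (K : Type*) [Field K] := (UT2 K)ˢʸᵐ

instance (K : Type*) [Field K] [NeZero (2 : K)] : NonAssocCommRing (UJ2 K) :=
  { (inferInstance : NonAssocRing (UT2 K)ˢʸᵐ) with
    mul_comm := SymAlg.mul_comm }

instance (K : Type*) [Field K] [NeZero (2 : K)] : IsCommJordan (UJ2 K) where
  lmul_comm_rmul_rmul a b :=
    IsCommJordan.lmul_comm_rmul_rmul (A := (UT2 K)ˢʸᵐ) a b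

instance (K : Type*) [Field K] [NeZero (2 : K)] : IsScalarTower K (UJ2 K) (UJ2 K) where
  smul_assoc c a b := by
    apply SymAlg.unsym_injective
    simp only [smul_eq_mul, SymAlg.unsym_mul, SymAlg.unsym_smul, smul_mul_assoc, mul_smul_comm,
      ← smul_add]

instance (K : Type*) [Field K] [NeZero (2 : K)] : SMulCommClass K (UJ2 K) (UJ2 K) where
  smul_comm c a b := by
    apply SymAlg.unsym_injective
    simp only [smul_eq_mul, SymAlg.unsym_mul, SymAlg.unsym_smul, smul_mul_assoc, mul_smul_comm,
      ← smul_add]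

open SymAlg in
/-- The even component `span {e₁₁ + e₂₂, e₁₂}` of `UJ₂` in the associative grading. -/
def assEven (K : Type*) [Field K] : Submodule K (UJ2 K) :=
  Submodule.span K {sym (e11 K + e22 K), sym (e12 K)}

open SymAlg in
/-- The odd component `span {e₁₁ - e₂₂}` of `UJ₂` in the associative grading. -/
def assOdd (K : Type*) [Field K] : Submodule K (UJ2 K) :=
  Submodule.span K {sym (e11 K - e22 K)}

/-- The value `f(Y₀, Y₁, …, Z₀, Z₁, …)` of `f ∈ J(X)` on elements of `UJ₂`. -/
def eval {K : Type*} [Field K] [NeZero (2 : K)] (Y Z : ℕ → UJ2 K) : J K →ₙₐ[K] UJ2 K :=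
  J.lift fun
    | .y i => Y i
    | .z i => Z i

/-- `T_Ass(UJ₂)`: the graded polynomial identities of `UJ₂` with the associative grading. -/
def TAss (K : Type*) [Field K] [NeZero (2 : K)] : Submodule K (J K) where
  carrier := {f | ∀ Y Z : ℕ → UJ2 K, (∀ i, Y i ∈ assEven K) → (∀ i, Z i ∈ assOdd K) →
    eval Y Z f = 0}
  add_mem' ha hb Y Z hY hZ := by rw [map_add, ha Y Z hY hZ, hb Y Z hY hZ, add_zero]
  zero_mem' Y Z _ _ := map_zero _
  smul_mem' c f hf Y Z hY hZ := by rw [map_smul, hf Y Z hY hZ, smul_zero]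

/-! ### The generating identities and the basis -/

/-- The left-normed product `f₁ f₂ ⋯ fₙ = (⋯ (f₁ f₂) ⋯) fₙ` (which is `1` for `n = 0`). -/
def leftProd {K : Type*} [Field K] (l : List (J K)) : J K := l.foldl (· * ·) 1

/-- The left-normed power `f^n = f f ⋯ f`. -/
def leftPow {K : Type*} [Field K] (f : J K) (n : ℕ) : J K := leftProd (List.replicate n f)

/-- The left-normed monomial `v₀^{k₀} v₁^{k₁} ⋯`: each `vᵢ` occurs `kᵢ` times, and the indices
are in increasing order. -/
def mono {K : Type*} [Field K] (v : ℕ → J K) (k : ℕ →₀ ℕ) : J K :=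
  leftProd (((Finsupp.toMultiset k).sort (· ≤ ·)).map v)

/-- The generating graded identities over a field with `q` elements; `associator u v w` is
`(uv)w - u(vw)`. -/
def generators (K : Type*) [Field K] (q : ℕ) : Set (J K) :=
  {associator (y K 1) (y K 2) (y K 3),
   associator (z K 1) (y K 1) (y K 2),
   associator (z K 1) (y K 1) (z K 2),
   associator (z K 1) (z K 2) (z K 3),
   associator (z K 1 * z K 2) (z K 3) (z K 4),
   (leftPow (y K 1) q - y K 1) * (leftPow (y K 2) q - y K 2),
   leftPow (z K 1) q - z K 1,
   (leftPow (y K 1) q - y K 1) * z K 1}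

/-- The exponents `(s₀, s₁, …)` (with finitely many nonzero entries) such that all `sᵢ < 2q` and
at most one `sᵢ` is `≥ q`. -/
def Lam (q : ℕ) : Set (ℕ →₀ ℕ) :=
  {s | (∀ i, s i < 2 * q) ∧ ∀ i, q ≤ s i → ∀ j, j ≠ i → s j < q}

/-- The parameters of the monomials `basisElem`. -/
inductive BasisIndex (q : ℕ) : Type
  | a (k : ℕ →₀ ℕ) (hk : k ∈ Lam q)
  | b (k : ℕ →₀ ℕ) (hk : ∀ i, k i < q)
      (t : ℕ →₀ ℕ) (ht : ∀ i, t i < q) (ht₀ : 0 < t.degree) (hte : Even t.degree)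
  | c (k : ℕ →₀ ℕ) (hk : ∀ i, k i < q) (j : ℕ)
      (t : ℕ →₀ ℕ) (htj : ∀ i, i < j → t i = 0) (htj' : t j + 1 < q) (ht : ∀ i, t i < q)
      (hte : Even t.degree)
  | d (i : ℕ) (k : ℕ →₀ ℕ) (hk : ∀ i, k i < q) (j l : ℕ) (hjl : j ≤ l)
      (t : ℕ →₀ ℕ) (htl : ∀ i, i < l → t i = 0) (ht : ∀ i, t i < q)
      (hlt : j < l → t l + 1 < q) (heq : j = l → t l + 2 < q) (hte : Even t.degree)

/-- The monomials (a) `y^k`, (b) `y^k z^t`, (c) `(y^k z_j) z^t`, (d) `(((y_i z_j) z_l) y^k) z^t`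
of `J(X)`. -/
def basisElem (K : Type*) [Field K] {q : ℕ} : BasisIndex q → J K
  | .a k _ => mono (y K) k
  | .b k _ t _ _ _ => mono (y K) k * mono (z K) t
  | .c k _ j t _ _ _ _ => (mono (y K) k * z K j) * mono (z K) t
  | .d i k _ j l _ t _ _ _ _ _ =>
      (((y K i * z K j) * z K l) * mono (y K) k) * mono (z K) t

end GradedUJ

end

/-!
The proof determines the multiplication of an algebra `A` that satisfies the generating identities,
with even part `E` and odd part `O`, and compares `J(X)/I'` with functions on a finite field.

*Spanning.* The identities say that `E` is a commutative associative algebra, that `O` is an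
`E`-module, and that the other triple products of homogeneous elements associate too, except that
`(a u) v` and `a (u v)` with `a` even and `u`, `v` odd may differ. The linearized Jordan identity makes the associator `(a, u, v)` a derivation
in `a`, so that it vanishes on `a^q`; since `a^q u = a u`, this gives `(a u) v = a^q (u v)`
(`SatisfiesIdentities.mul_odd_mul_odd`). Hence the normal forms `y^k z^s`, for arbitrary exponents,
are closed under products and span `J(X)/I'`. The identities of degree `q` reduce the exponents to
those in `reducedExps q`, where `k ∈ Lam q`, all `s_j < q`, and all `k_i < q` if `|s|` is odd. In
`J(X)/I'` each of the monomials (a)–(d) is a normal form; for (d) the twist turns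
`(((y_i z_j) z_l) y^k) z^t` into `y^k y_i^q z^t z_j z_l`. This is a bijection onto the reduced
normal forms (`BasisIndex.exps`, `map_basisElem`).

*Independence.* In `UJ₂`, substitute `a_j + δ_{ij} e₁₂` for `y_j` and `c_j (e₁₁ - e₂₂)` for `z_j`.
The even part of a combination of normal forms yields the values of a polynomial and of its
derivative with respect to `y_i`. As a polynomial in `y_i` it has degree `< 2q` and a double root
at every point of `K`, so it is zero, and by Dedekind's independence of characters the coefficients
of all monomials with an exponent `≥ q` vanish. The remaining monomials have all exponents `< q`
and are independent as functions, again by Dedekind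
(`eq_zero_of_linearCombination_mem_TAss`).

As `UJ₂` satisfies the generators, `I' ⊆ T_Ass(UJ₂)`; spanning modulo the smaller ideal and
independence modulo the larger one give both the equality and the basis.
-/

noncomputable section

namespace GradedUJ

/-! ### Left-normed products -/

section LeftNormed

variable {A : Type*} [NonAssocRing A]

/-- The left-normed product of a list in an arbitrary ring; `leftProd` is the case of `J(X)`. -/
def lprod (l : List A) : A := l.foldl (· * ·) 1

/-- The left-normed power in an arbitrary ring. -/
def lpow (a : A) (n : ℕ) : A := lprod (List.replicate n a)

/-- The left-normed monomial `v₀^{k₀} v₁^{k₁} ⋯` in an arbitrary ring. -/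
def lmono (v : ℕ → A) (k : ℕ →₀ ℕ) : A :=
  lprod (((Finsupp.toMultiset k).sort (· ≤ ·)).map v)

theorem lpow_zero (a : A) : lpow a 0 = 1 := rfl

theorem lpow_succ (a : A) (n : ℕ) : lpow a (n + 1) = lpow a n * a := by
  rw [lpow, lprod, List.replicate_succ', List.foldl_append]
  rfl

theorem lmono_zero (v : ℕ → A) : lmono v 0 = 1 := by simp [lmono, lprod]

theorem foldl_mul_eq_of_perm {v : ℕ → A} {T : Set A} (hT : ∀ u ∈ T, ∀ i, u * v i ∈ T)
    (hc : ∀ u ∈ T, ∀ i j, u * v i * v j = u * v j * v i) {l₁ l₂ : List ℕ} (h : l₁.Perm l₂) :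
    ∀ u ∈ T, (l₁.map v).foldl (· * ·) u = (l₂.map v).foldl (· * ·) u := by
  induction h with
  | nil => intro u _; rfl
  | cons x _ ih => intro u hu; exact ih _ (hT u hu x)
  | swap x y l =>
    intro u hu
    simp only [List.map_cons, List.foldl_cons]
    rw [hc u hu]
  | trans _ _ ih₁ ih₂ => intro u hu; exact (ih₁ u hu).trans (ih₂ u hu)

/-- If right multiplications by the `v i` commute with each other on a set `T` that contains `1`
and is stable under them, then left-normed monomials can be multiplied by `v i` in any order. -/
theorem lmono_add_single {v : ℕ → A} (T : Set A) (h1 : (1 : A) ∈ T)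
    (hT : ∀ u ∈ T, ∀ i, u * v i ∈ T)
    (hc : ∀ u ∈ T, ∀ i j, u * v i * v j = u * v j * v i) (k : ℕ →₀ ℕ) (i : ℕ) :
    lmono v (k + Finsupp.single i 1) = lmono v k * v i := by
  have hp : ((Finsupp.toMultiset (k + Finsupp.single i 1)).sort (· ≤ ·)).Perm
      ((Finsupp.toMultiset k).sort (· ≤ ·) ++ [i]) := by
    rw [← Multiset.coe_eq_coe, Multiset.sort_eq, ← Multiset.coe_add, Multiset.sort_eq, map_add,
      Finsupp.toMultiset_single, one_smul, Multiset.coe_singleton]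
  rw [lmono, lprod, foldl_mul_eq_of_perm hT hc hp 1 h1, List.map_append, List.foldl_append]
  rfl

/-- Induction on exponent sequences, increasing one exponent by `1` at a time. -/
theorem exponent_induction {p : (ℕ →₀ ℕ) → Prop} (k : ℕ →₀ ℕ) (zero : p 0)
    (add_single : ∀ k i, p k → p (k + Finsupp.single i 1)) : p k := by
  induction k using Finsupp.induction_linear with
  | zero => exact zero
  | add f g hf hg =>
    clear hg
    induction g using Finsupp.induction_linear generalizing f with
    | zero => simpa using hf
    | add g h ihg ihh =>
      rw [← add_assoc]
      exact ihh _ (ihg _ hf)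
    | single a b =>
      induction b with
      | zero => simpa using hf
      | succ b ih => rw [Finsupp.single_add, ← add_assoc]; exact add_single _ _ ih
  | single a b =>
    induction b with
    | zero => simpa using zero
    | succ b ih => rw [Finsupp.single_add]; exact add_single _ _ ih

end LeftNormed

/-! ### Consequences of the identities -/

section Identities

variable {K : Type*} [Field K] {A : Type*} [NonAssocCommRing A] [Module K A]

/-- The even part `E` and the odd part `O` of `A` are closed under products as in a
`ℤ₂`-graded algebra, and satisfy the generating identities. -/
structure SatisfiesIdentities (q : ℕ) (E O : Submodule K A) : Prop where
  one_mem : (1 : A) ∈ E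
  mul_ee : ∀ {a b : A}, a ∈ E → b ∈ E → a * b ∈ E
  mul_eo : ∀ {a u : A}, a ∈ E → u ∈ O → a * u ∈ O
  mul_oo : ∀ {u v : A}, u ∈ O → v ∈ O → u * v ∈ E
  assoc_eee : ∀ {a b c : A}, a ∈ E → b ∈ E → c ∈ E → a * b * c = a * (b * c)
  assoc_oee : ∀ {u a b : A}, u ∈ O → a ∈ E → b ∈ E → u * a * b = u * (a * b)
  assoc_oeo : ∀ {u a v : A}, u ∈ O → a ∈ E → v ∈ O → u * a * v = u * (a * v)
  assoc_ooo : ∀ {u v w : A}, u ∈ O → v ∈ O → w ∈ O → u * v * w = u * (v * w)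
  assoc_oo_o_o : ∀ {u v w x : A}, u ∈ O → v ∈ O → w ∈ O → x ∈ O →
    u * v * w * x = u * v * (w * x)
  frob_mul_frob : ∀ {a b : A}, a ∈ E → b ∈ E → (lpow a q - a) * (lpow b q - b) = 0
  lpow_odd : ∀ {u : A}, u ∈ O → lpow u q = u
  frob_mul_odd : ∀ {a u : A}, a ∈ E → u ∈ O → (lpow a q - a) * u = 0

namespace SatisfiesIdentities

variable {q : ℕ} {E O : Submodule K A} (h : SatisfiesIdentities q E O)
include h

theorem mul_oe {a u : A} (hu : u ∈ O) (ha : a ∈ E) : u * a ∈ O := mul_comm a u ▸ h.mul_eo ha hu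

/-- The odd part is a module over the commutative associative even part. -/
theorem assoc_eeo {a b u : A} (ha : a ∈ E) (hb : b ∈ E) (hu : u ∈ O) :
    a * b * u = a * (b * u) := by
  rw [mul_comm, mul_comm a b, ← h.assoc_oee hu hb ha, mul_comm, mul_comm u]

theorem lpow_mem {a : A} (ha : a ∈ E) (n : ℕ) : lpow a n ∈ E := by
  induction n with
  | zero => exact h.one_mem
  | succ n ih => rw [lpow_succ]; exact h.mul_ee ih ha

/-- The associator `(a, u, v)` with `a` even and `u`, `v` odd is a derivation in `a`. This is
the linearized Jordan identity. -/
theorem associator_mul [IsCommJordan A] [NeZero (2 : K)] {a b u v : A} (ha : a ∈ E)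
    (hb : b ∈ E) (hu : u ∈ O) (hv : v ∈ O) :
    associator (a * b) u v = a * associator b u v + b * associator a u v := by
  have key : a * (b * v * u) - b * v * (a * u) + (b * (v * a * u) - v * a * (b * u)) +
      (v * (a * b * u) - a * b * (v * u)) = 0 := by
    have h3 : (2 : K) • (⁅AddMonoid.End.mulLeft a, AddMonoid.End.mulLeft (b * v)⁆ +
          ⁅AddMonoid.End.mulLeft b, AddMonoid.End.mulLeft (v * a)⁆ +
        ⁅AddMonoid.End.mulLeft v, AddMonoid.End.mulLeft (a * b)⁆) u = 0 := by
      rw [ofNat_smul_eq_nsmul]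
      exact DFunLike.congr_fun (two_nsmul_lie_lmul_lmul_add_add_eq_zero a b v) u
    exact (smul_eq_zero.1 h3).resolve_left (NeZero.ne _)
  have e1 : b * v * (a * u) = a * b * u * v := by
    rw [mul_comm a u, mul_comm (b * v), h.assoc_oeo hu ha (h.mul_eo hb hv),
      ← h.assoc_eeo ha hb hv, ← h.assoc_oeo hu (h.mul_ee ha hb) hv, mul_comm u]
  have e2 : v * a * (b * u) = a * b * u * v := by
    rw [h.assoc_oeo hv ha (h.mul_eo hb hu), ← h.assoc_eeo ha hb hu, mul_comm]
  have e3 : b * v * u = b * u * v := by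
    rw [mul_comm, ← h.assoc_oeo hu hb hv, mul_comm u]
  have e4 : v * a * u = a * u * v := by rw [h.assoc_oeo hv ha hu, mul_comm]
  have e5 : b * (a * (u * v)) = a * b * (u * v) := by
    rw [← h.assoc_eee hb ha (h.mul_oo hu hv), mul_comm b a]
  rw [e1, e2, e3, e4, mul_comm v, mul_comm v] at key
  rw [associator_apply, associator_apply, associator_apply, mul_sub, mul_sub, e5,
    ← h.assoc_eee ha hb (h.mul_oo hu hv), ← sub_eq_zero, ← neg_eq_zero, ← key]
  abel

theorem associator_mem {a u v : A} (ha : a ∈ E) (hu : u ∈ O) (hv : v ∈ O) :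
    associator a u v ∈ E :=
  E.sub_mem (h.mul_oo (h.mul_eo ha hu) hv) (h.mul_ee ha (h.mul_oo hu hv))

theorem associator_lpow_succ [IsCommJordan A] [NeZero (2 : K)] {a u v : A} (ha : a ∈ E)
    (hu : u ∈ O) (hv : v ∈ O) (n : ℕ) :
    associator (lpow a (n + 1)) u v = (n + 1) • (lpow a n * associator a u v) := by
  induction n with
  | zero => simp [lpow_succ, lpow_zero]
  | succ n ih =>
    rw [lpow_succ, h.associator_mul (h.lpow_mem ha _) ha hu hv, ih, add_smul (n + 1) 1, add_comm,
      one_smul, mul_smul_comm, ← h.assoc_eee ha (h.lpow_mem ha n) (h.associator_mem ha hu hv),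
      mul_comm a, ← lpow_succ]

/-- A Frobenius twist governs the products of odd elements: `(a u) v = a^q (u v)`. Indeed
`a u = a^q u`, and the derivation `a ↦ (a, u, v)` kills `a^q`. -/
theorem mul_odd_mul_odd [IsCommJordan A] [NeZero (2 : K)] (hq : (q : K) = 0) (hq0 : q ≠ 0)
    {a u v : A} (ha : a ∈ E) (hu : u ∈ O) (hv : v ∈ O) : a * u * v = lpow a q * (u * v) := by
  have h1 : lpow a q * u = a * u := by
    rw [← sub_eq_zero, ← sub_mul]; exact h.frob_mul_odd ha hu
  have h2 : associator (lpow a q) u v = 0 := by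
    obtain ⟨n, rfl⟩ := Nat.exists_eq_succ_of_ne_zero hq0
    rw [h.associator_lpow_succ ha hu hv, ← Nat.cast_smul_eq_nsmul K]
    rw [Nat.succ_eq_add_one] at hq
    rw [hq, zero_smul]
  rw [← h1]
  exact sub_eq_zero.1 h2

/-! ### Monomials in the even and in the odd variables -/

section Monomials

variable {Y Z : ℕ → A} (hY : ∀ i, Y i ∈ E) (hZ : ∀ i, Z i ∈ O)

section Even
include hY

theorem lmono_even_add_single (k : ℕ →₀ ℕ) (i : ℕ) :
    lmono Y (k + Finsupp.single i 1) = lmono Y k * Y i :=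
  lmono_add_single (E : Set A) h.one_mem (fun _ hu i => h.mul_ee hu (hY i))
    (fun u hu i j => by
      rw [h.assoc_eee hu (hY i) (hY j), mul_comm (Y i), h.assoc_eee hu (hY j) (hY i)]) k i

theorem lmono_even_mem (k : ℕ →₀ ℕ) : lmono Y k ∈ E := by
  induction k using exponent_induction with
  | zero => rw [lmono_zero]; exact h.one_mem
  | add_single k i ih => rw [h.lmono_even_add_single hY]; exact h.mul_ee ih (hY i)

theorem lmono_even_add (k l : ℕ →₀ ℕ) : lmono Y (k + l) = lmono Y k * lmono Y l := by
  induction l using exponent_induction with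
  | zero => rw [lmono_zero, add_zero, mul_one]
  | add_single l i ih =>
    rw [← add_assoc, h.lmono_even_add_single hY, h.lmono_even_add_single hY, ih,
      h.assoc_eee (h.lmono_even_mem hY k) (h.lmono_even_mem hY l) (hY i)]

theorem lpow_lmono_even (k : ℕ →₀ ℕ) (n : ℕ) : lpow (lmono Y k) n = lmono Y (n • k) := by
  induction n with
  | zero => rw [zero_smul, lmono_zero, lpow_zero]
  | succ n ih => rw [lpow_succ, ih, add_smul, one_smul, h.lmono_even_add hY]

theorem lmono_even_single (i n : ℕ) : lmono Y (Finsupp.single i n) = lpow (Y i) n := by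
  induction n with
  | zero => rw [Finsupp.single_zero, lmono_zero, lpow_zero]
  | succ n ih => rw [Finsupp.single_add, h.lmono_even_add_single hY, ih, lpow_succ]

end Even

section Odd
include hZ

theorem lmono_odd_add_single (s : ℕ →₀ ℕ) (j : ℕ) :
    lmono Z (s + Finsupp.single j 1) = lmono Z s * Z j := by
  have hass : ∀ u ∈ {u | u ∈ O ∨ u ∈ E ∧ ∀ v ∈ O, ∀ w ∈ O, u * v * w = u * (v * w)},
      ∀ i j, u * Z i * Z j = u * (Z i * Z j) := by
    rintro u (hu | ⟨-, hu⟩) i j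
    · exact h.assoc_ooo hu (hZ i) (hZ j)
    · exact hu _ (hZ i) _ (hZ j)
  -- The stable set consists of the odd elements and of the even elements that associate with pairs
  -- of odd elements; by `assoc_oo_o_o` products of two odd elements are among the latter.
  refine lmono_add_single {u | u ∈ O ∨ u ∈ E ∧ ∀ v ∈ O, ∀ w ∈ O, u * v * w = u * (v * w)}
    (.inr ⟨h.one_mem, fun v _ w _ => by rw [one_mul, one_mul]⟩) ?_
    (fun u hu i j => by rw [hass u hu, hass u hu, mul_comm (Z i)]) s j
  rintro u (hu | ⟨hu, -⟩) i
  · exact .inr ⟨h.mul_oo hu (hZ i), fun v hv w hw => h.assoc_oo_o_o hu (hZ i) hv hw⟩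
  · exact .inl (h.mul_eo hu (hZ i))

/-- Monomials in odd variables have the parity of their degree; those of even degree associate
with pairs of odd elements. -/
theorem lmono_odd_parity (s : ℕ →₀ ℕ) :
    (Even s.degree → lmono Z s ∈ E ∧ ∀ v ∈ O, ∀ w ∈ O, lmono Z s * v * w = lmono Z s * (v * w)) ∧
      (Odd s.degree → lmono Z s ∈ O) := by
  induction s using exponent_induction with
  | zero =>
    rw [lmono_zero]
    exact ⟨fun _ => ⟨h.one_mem, fun v _ w _ => by rw [one_mul, one_mul]⟩, fun hs => by simp at hs⟩
  | add_single s j ih =>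
    rw [h.lmono_odd_add_single hZ, map_add, Finsupp.degree_single, Nat.even_add_one,
      Nat.odd_add_one, Nat.not_even_iff_odd, Nat.not_odd_iff_even]
    exact ⟨fun hs => ⟨h.mul_oo (ih.2 hs) (hZ j),
      fun v hv w hw => h.assoc_oo_o_o (ih.2 hs) (hZ j) hv hw⟩,
      fun hs => h.mul_eo (ih.1 hs).1 (hZ j)⟩

theorem lmono_odd_mem_even {s : ℕ →₀ ℕ} (hs : Even s.degree) : lmono Z s ∈ E :=
  ((h.lmono_odd_parity hZ s).1 hs).1

theorem lmono_odd_mem_odd {s : ℕ →₀ ℕ} (hs : Odd s.degree) : lmono Z s ∈ O :=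
  (h.lmono_odd_parity hZ s).2 hs

theorem lmono_odd_add (s t : ℕ →₀ ℕ) : lmono Z (s + t) = lmono Z s * lmono Z t := by
  induction t using exponent_induction with
  | zero => rw [lmono_zero, add_zero, mul_one]
  | add_single t j ih =>
    rw [← add_assoc, h.lmono_odd_add_single hZ, h.lmono_odd_add_single hZ, ih]
    rcases Nat.even_or_odd s.degree with hs | hs <;> rcases Nat.even_or_odd t.degree with ht | ht
    · exact h.assoc_eeo (h.lmono_odd_mem_even hZ hs) (h.lmono_odd_mem_even hZ ht) (hZ j)
    · exact ((h.lmono_odd_parity hZ s).1 hs).2 _ (h.lmono_odd_mem_odd hZ ht) _ (hZ j)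
    · exact h.assoc_oeo (h.lmono_odd_mem_odd hZ hs) (h.lmono_odd_mem_even hZ ht) (hZ j)
    · exact h.assoc_ooo (h.lmono_odd_mem_odd hZ hs) (h.lmono_odd_mem_odd hZ ht) (hZ j)

theorem lmono_odd_single (j n : ℕ) : lmono Z (Finsupp.single j n) = lpow (Z j) n := by
  induction n with
  | zero => rw [Finsupp.single_zero, lmono_zero, lpow_zero]
  | succ n ih => rw [Finsupp.single_add, h.lmono_odd_add_single hZ, ih, lpow_succ]

/-- Exponents of odd variables may be lowered by `q - 1` as long as they stay positive. -/
theorem lmono_odd_reduce (s : ℕ →₀ ℕ) (j : ℕ) :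
    lmono Z (s + Finsupp.single j q) = lmono Z (s + Finsupp.single j 1) := by
  rw [h.lmono_odd_add hZ, h.lmono_odd_single hZ, h.lpow_odd (hZ j), h.lmono_odd_add_single hZ]

end Odd

end Monomials

end SatisfiesIdentities

end Identities

/-! ### Reduction of monomials -/

section Reduction

variable {K : Type*} [Field K] {A : Type*} [NonAssocCommRing A] [Module K A]

/-- The normal form `y^k z^s` attached to a pair of exponent sequences `p = (k, s)`. -/
def normalMono (Y Z : ℕ → A) (p : (ℕ →₀ ℕ) × (ℕ →₀ ℕ)) : A := lmono Y p.1 * lmono Z p.2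

/-- The reduced pairs of exponent sequences `(k, s)`: they index the normal forms `y^k z^s` which
form a basis. -/
def reducedExps (q : ℕ) : Set ((ℕ →₀ ℕ) × (ℕ →₀ ℕ)) :=
  {p | p.1 ∈ Lam q ∧ (∀ j, p.2 j < q) ∧ (Odd p.2.degree → ∀ i, p.1 i < q)}

theorem exists_eq_add_single {k : ℕ →₀ ℕ} {i n : ℕ} (hi : n ≤ k i) :
    ∃ k', k = k' + Finsupp.single i n := by
  classical
  refine ⟨k - Finsupp.single i n, (tsub_add_cancel_of_le fun j => ?_).symm⟩
  rw [Finsupp.single_apply]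
  split_ifs with hij
  · exact hij ▸ hi
  · exact Nat.zero_le _

/-- An exponent sequence outside `Lam q` is divisible by `y_i^q y_j^q` for some, possibly equal,
`i` and `j`. -/
theorem exists_eq_add_single_add_single {q : ℕ} {k : ℕ →₀ ℕ} (hk : k ∉ Lam q) :
    ∃ k' i j, k = k' + (Finsupp.single i q + Finsupp.single j q) := by
  classical
  by_cases h1 : ∃ i, 2 * q ≤ k i
  · obtain ⟨i, hi⟩ := h1
    obtain ⟨k', rfl⟩ := exists_eq_add_single hi
    exact ⟨k', i, i, by rw [← Finsupp.single_add, two_mul]⟩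
  · push Not at h1
    have h2 : ∃ i, q ≤ k i ∧ ∃ j, j ≠ i ∧ q ≤ k j := by
      by_contra! hc
      exact hk ⟨h1, hc⟩
    obtain ⟨i, hi, j, hji, hj⟩ := h2
    obtain ⟨k', rfl⟩ := exists_eq_add_single hi
    rw [Finsupp.add_apply, Finsupp.single_eq_of_ne hji, add_zero] at hj
    obtain ⟨k'', rfl⟩ := exists_eq_add_single hj
    exact ⟨k'', j, i, by rw [add_assoc]⟩

namespace SatisfiesIdentities

variable {q : ℕ} {E O : Submodule K A} (h : SatisfiesIdentities q E O)
  {Y Z : ℕ → A} (hY : ∀ i, Y i ∈ E) (hZ : ∀ i, Z i ∈ O)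
include h hY hZ

/-- The normal forms are closed under products, up to the Frobenius twist in products of odd
elements. -/
theorem exists_normalMono_mul [IsCommJordan A] [NeZero (2 : K)] (hq : (q : K) = 0) (hq0 : q ≠ 0)
    (p r : (ℕ →₀ ℕ) × (ℕ →₀ ℕ)) :
    ∃ m, normalMono Y Z p * normalMono Y Z r = normalMono Y Z m := by
  obtain ⟨k, s⟩ := p
  obtain ⟨l, t⟩ := r
  have hk := h.lmono_even_mem hY k
  have hl := h.lmono_even_mem hY l
  have hEO : ∀ {k s l t : ℕ →₀ ℕ}, Even s.degree → Odd t.degree →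
      normalMono Y Z (k, s) * normalMono Y Z (l, t) = normalMono Y Z (k + l, s + t) := by
    intro k s l t hs ht
    have hk := h.lmono_even_mem hY k
    have hl := h.lmono_even_mem hY l
    have hs' := h.lmono_odd_mem_even hZ hs
    have ht' := h.lmono_odd_mem_odd hZ ht
    simp only [normalMono]
    rw [h.lmono_even_add hY, h.lmono_odd_add hZ,
      h.assoc_eeo (h.mul_ee hk hl) hs' ht' |>.symm, h.assoc_eee hk hl hs',
      mul_comm (lmono Y l) (lmono Z s), ← h.assoc_eee hk hs' hl,
      h.assoc_eeo (h.mul_ee hk hs') hl ht']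
  rcases Nat.even_or_odd s.degree with hs | hs <;> rcases Nat.even_or_odd t.degree with ht | ht
  · refine ⟨(k + l, s + t), ?_⟩
    have hs' := h.lmono_odd_mem_even hZ hs
    have ht' := h.lmono_odd_mem_even hZ ht
    simp only [normalMono]
    rw [h.lmono_even_add hY, h.lmono_odd_add hZ, h.assoc_eee hk hs' (h.mul_ee hl ht'),
      ← h.assoc_eee hs' hl ht', mul_comm (lmono Z s) (lmono Y l), h.assoc_eee hl hs' ht',
      ← h.assoc_eee hk hl (h.mul_ee hs' ht')]
  · exact ⟨_, hEO hs ht⟩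
  · exact ⟨_, (mul_comm _ _).trans (hEO ht hs)⟩
  · refine ⟨(q • (k + l), s + t), ?_⟩
    have hs' := h.lmono_odd_mem_odd hZ hs
    have ht' := h.lmono_odd_mem_odd hZ ht
    simp only [normalMono]
    rw [← h.lpow_lmono_even hY, h.lmono_odd_add hZ,
      ← h.mul_odd_mul_odd hq hq0 (h.lmono_even_mem hY _) hs' ht', h.lmono_even_add hY,
      mul_comm (lmono Y k) (lmono Z s), h.assoc_oeo hs' hk (h.mul_eo hl ht'),
      ← h.assoc_eeo hk hl ht', ← h.assoc_oeo hs' (h.mul_ee hk hl) ht', mul_comm (lmono Z s)]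

/-- The span of all normal forms is a subalgebra. -/
theorem mul_mem_span_normalMono [IsScalarTower K A A] [SMulCommClass K A A] [IsCommJordan A]
    [NeZero (2 : K)] (hq : (q : K) = 0) (hq0 : q ≠ 0) {a b : A}
    (ha : a ∈ Submodule.span K (Set.range (normalMono Y Z)))
    (hb : b ∈ Submodule.span K (Set.range (normalMono Y Z))) :
    a * b ∈ Submodule.span K (Set.range (normalMono Y Z)) := by
  have hab := Submodule.apply_mem_map₂ (LinearMap.mul K A) ha hb
  rw [Submodule.map₂_span_span] at hab
  refine Submodule.span_le.2 ?_ hab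
  rintro _ ⟨_, ⟨p, rfl⟩, _, ⟨r, rfl⟩, rfl⟩
  obtain ⟨m, hm⟩ := h.exists_normalMono_mul hY hZ hq hq0 p r
  exact Submodule.subset_span ⟨m, hm.symm⟩

/-- Every normal form reduces to combinations of reduced ones, by induction on the total degree:
the identities of degree `q` rewrite any other normal form in terms of smaller degrees. -/
theorem normalMono_mem_span_reduced (hq : 2 ≤ q)
    (p : (ℕ →₀ ℕ) × (ℕ →₀ ℕ)) :
    normalMono Y Z p ∈ Submodule.span K (normalMono Y Z '' reducedExps q) := by
  induction hn : p.1.degree + p.2.degree using Nat.strong_induction_on generalizing p with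
  | _ n ih =>
  obtain ⟨k, s⟩ := p
  replace ih : ∀ k' s' : ℕ →₀ ℕ, k'.degree + s'.degree < k.degree + s.degree →
      normalMono Y Z (k', s') ∈ Submodule.span K (normalMono Y Z '' reducedExps q) :=
    fun k' s' hlt => ih _ (hn ▸ hlt) (k', s') rfl
  -- Lower an exponent of an odd variable by `z_j^q = z_j`.
  by_cases hs : ∀ j, s j < q
  swap
  · push Not at hs
    obtain ⟨j, hj⟩ := hs
    obtain ⟨s', rfl⟩ := exists_eq_add_single hj
    have := ih k (s' + Finsupp.single j 1) (by simp; omega)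
    rwa [normalMono, ← h.lmono_odd_reduce hZ] at this
  -- Expand `(y_i^q - y_i) (y_j^q - y_j) = 0`.
  by_cases hk : k ∈ Lam q
  swap
  · obtain ⟨k', i, j, rfl⟩ := exists_eq_add_single_add_single hk
    have h0 := h.frob_mul_frob (hY i) (hY j)
    have h1 := ih (k' + (Finsupp.single i q + Finsupp.single j 1)) s (by simp; omega)
    have h2 := ih (k' + (Finsupp.single i 1 + Finsupp.single j q)) s (by simp; omega)
    have h3 := ih (k' + (Finsupp.single i 1 + Finsupp.single j 1)) s (by simp; omega)
    convert Submodule.sub_mem _ (Submodule.add_mem _ h1 h2) h3 using 1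
    simp only [normalMono]
    rw [← add_mul, ← sub_mul]
    congr 1
    simp only [h.lmono_even_add hY k']
    rw [← mul_add, ← mul_sub]
    congr 1
    have e1 : ∀ i, lmono Y (Finsupp.single i 1) = Y i := fun i => by
      rw [h.lmono_even_single hY, lpow_succ, lpow_zero, one_mul]
    simp only [h.lmono_even_add hY, e1]
    rw [h.lmono_even_single hY, h.lmono_even_single hY, ← sub_eq_zero, ← h0, sub_mul, mul_sub,
      mul_sub]
    abel
  -- Replace `y_i^q` by `y_i` in front of an odd element.
  by_cases ho : Odd s.degree → ∀ i, k i < q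
  · exact Submodule.subset_span ⟨(k, s), ⟨hk, hs, ho⟩, rfl⟩
  · push Not at ho
    obtain ⟨ho, i, hi⟩ := ho
    obtain ⟨k', rfl⟩ := exists_eq_add_single hi
    have hsO := h.lmono_odd_mem_odd hZ ho
    have := ih (k' + Finsupp.single i 1) s (by simp; omega)
    convert this using 1
    simp only [normalMono]
    rw [h.lmono_even_add hY, h.lmono_even_add_single hY, h.lmono_even_single hY,
      h.assoc_eeo (h.lmono_even_mem hY k') (h.lpow_mem (hY i) q) hsO,
      h.assoc_eeo (h.lmono_even_mem hY k') (hY i) hsO]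
    congr 1
    rw [← sub_eq_zero, ← sub_mul]
    exact h.frob_mul_odd (hY i) hsO

/-- The monomials (c) in normal form. -/
theorem mul_odd_mul_lmono (k t : ℕ →₀ ℕ) (j : ℕ) (ht : Even t.degree) :
    lmono Y k * Z j * lmono Z t = normalMono Y Z (k, t + Finsupp.single j 1) := by
  rw [normalMono, h.lmono_odd_add_single hZ, mul_comm (lmono Y k) (Z j),
    mul_comm (lmono Z t) (Z j), mul_comm (Z j), mul_comm, mul_comm (Z j),
    ← h.assoc_eeo (h.lmono_odd_mem_even hZ ht) (h.lmono_even_mem hY k) (hZ j),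
    mul_comm (lmono Z t) (lmono Y k),
    h.assoc_eeo (h.lmono_even_mem hY k) (h.lmono_odd_mem_even hZ ht) (hZ j)]

/-- The monomials (d) in normal form. -/
theorem mul_odd_mul_odd_mul_lmono [IsCommJordan A] [NeZero (2 : K)] (hq : (q : K) = 0)
    (hq0 : q ≠ 0) (k t : ℕ →₀ ℕ) (i j l : ℕ) (ht : Even t.degree) :
    Y i * Z j * Z l * lmono Y k * lmono Z t =
      normalMono Y Z (k + Finsupp.single i q, t + Finsupp.single j 1 + Finsupp.single l 1) := by
  have hk := h.lmono_even_mem hY k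
  have ht' := h.lmono_odd_mem_even hZ ht
  have hi := h.lpow_mem (hY i) q
  have hjl := h.mul_oo (hZ j) (hZ l)
  rw [h.mul_odd_mul_odd hq hq0 (hY i) (hZ j) (hZ l), normalMono, h.lmono_even_add hY,
    h.lmono_odd_add_single hZ, h.lmono_odd_add_single hZ,
    ((h.lmono_odd_parity hZ t).1 ht).2 _ (hZ j) _ (hZ l), h.lmono_even_single hY,
    mul_comm (lmono Z t), mul_comm (lmono Y k) (lpow (Y i) q), h.assoc_eee hi hjl hk,
    mul_comm (Z j * Z l) (lmono Y k), ← h.assoc_eee hi hk hjl,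
    h.assoc_eee (h.mul_ee hi hk) hjl ht']

end SatisfiesIdentities

end Reduction

/-! ### The index set of the basis -/

section Index

variable {q : ℕ}

/-- The exponents of the normal form of a basis monomial. The factor `y_i` of a monomial of
type (d) contributes `q` to the exponent of `y_i`, because of the Frobenius twist. -/
def BasisIndex.exps : BasisIndex q → (ℕ →₀ ℕ) × (ℕ →₀ ℕ)
  | .a k _ => (k, 0)
  | .b k _ t _ _ _ => (k, t)
  | .c k _ j t _ _ _ _ => (k, t + Finsupp.single j 1)
  | .d i k _ j l _ t _ _ _ _ _ =>
      (k + Finsupp.single i q, t + Finsupp.single j 1 + Finsupp.single l 1)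

theorem BasisIndex.exps_mem (hq : 2 ≤ q) (x : BasisIndex q) : x.exps ∈ reducedExps q := by
  classical
  cases x with
  | a k hk =>
    refine ⟨hk, fun j => ?_, fun ho => by simp [exps] at ho⟩
    simp only [exps, Finsupp.coe_zero, Pi.zero_apply]
    omega
  | b k hk t ht ht₀ hte =>
    refine ⟨⟨fun i => ?_, fun i hi => ?_⟩, ht, fun _ => hk⟩
    · exact (hk i).trans (by omega)
    · exact absurd (hk i) (not_lt.2 hi)
  | c k hk j t htj htj' ht hte =>
    refine ⟨⟨fun i => ?_, fun i hi => ?_⟩, fun m => ?_, fun _ => hk⟩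
    · exact (hk i).trans (by omega)
    · exact absurd (hk i) (not_lt.2 hi)
    · have := ht m
      simp only [exps, Finsupp.add_apply, Finsupp.single_apply]
      split_ifs with hm
      · subst hm; omega
      · omega
  | d i k hk j l hjl t htl ht hlt heq hte =>
    refine ⟨⟨fun m => ?_, fun m hm n hn => ?_⟩, fun m => ?_, fun ho => ?_⟩
    · have := hk m
      simp only [exps, Finsupp.add_apply, Finsupp.single_apply]
      split_ifs <;> omega
    · have h1 := hk m
      have h2 := hk n
      simp only [exps, Finsupp.add_apply, Finsupp.single_apply] at hm ⊢
      split_ifs at hm ⊢ <;> omega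
    · have h1 := ht m
      simp only [exps, Finsupp.add_apply, Finsupp.single_apply]
      rcases hjl.lt_or_eq with hjl' | rfl
      · have h2 := hlt hjl'
        have h3 := htl j hjl'
        split_ifs with h4 h5 h5
        · omega
        · subst h4; omega
        · subst h5; omega
        · omega
      · have h2 := heq rfl
        split_ifs with h4
        · subst h4; omega
        · omega
    · simp only [exps, map_add, Finsupp.degree_single, add_assoc] at ho
      exact absurd ho (Nat.not_odd_iff_even.2 (hte.add even_two))

/-- The first index of a nonzero exponent is recovered from `t + single j 1` if `t` vanishes
below `j`. -/
theorem eq_of_add_single_eq {t t' : ℕ →₀ ℕ} {j j' : ℕ} (ht : ∀ i, i < j → t i = 0)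
    (ht' : ∀ i, i < j' → t' i = 0)
    (h : t + Finsupp.single j 1 = t' + Finsupp.single j' 1) : j = j' ∧ t = t' := by
  classical
  have hj : j = j' := by
    have h1 := DFunLike.congr_fun h j
    have h2 := DFunLike.congr_fun h j'
    have h3 := ht j'
    have h4 := ht' j
    simp only [Finsupp.add_apply, Finsupp.single_apply] at h1 h2
    split_ifs at h1 h2 <;> omega
  subst hj
  exact ⟨rfl, add_right_cancel h⟩

theorem BasisIndex.exps_injective :
    Function.Injective (exps : BasisIndex q → _) := by
  classical
  -- The type of a monomial is visible from the parity and the vanishing of `s` and from the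
  -- presence of an exponent `≥ q` in `k`.
  have hd : ∀ {k k' : ℕ →₀ ℕ} {i : ℕ}, (∀ m, k m < q) → k ≠ k' + Finsupp.single i q := by
    rintro k k' i hk rfl
    have := hk i
    simp at this
  intro x x' hxx
  cases x <;> cases x' <;>
    simp only [exps, Prod.mk.injEq] at hxx <;> obtain ⟨h1, h2⟩ := hxx
  case a.a => subst h1; rfl
  case a.b ht₀ _ => subst h2; simp at ht₀
  case a.c => simpa using DFunLike.congr_arg Finsupp.degree h2
  case a.d => simpa using DFunLike.congr_arg Finsupp.degree h2
  case b.a ht₀ _ _ _ => subst h2; simp at ht₀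
  case b.b => subst h1 h2; rfl
  case b.c hte _ _ _ _ _ _ _ hte' =>
    rw [h2, map_add, Finsupp.degree_single] at hte
    exact absurd hte (Nat.not_even_iff_odd.2 hte'.add_one)
  case b.d hk _ _ _ _ _ _ _ _ _ _ _ _ _ _ _ _ => exact absurd h1 (hd hk)
  case c.a => simpa using DFunLike.congr_arg Finsupp.degree h2
  case c.b hte _ _ _ _ _ hte' =>
    rw [← h2, map_add, Finsupp.degree_single] at hte'
    exact absurd hte' (Nat.not_even_iff_odd.2 hte.add_one)
  case c.c htj _ _ _ _ _ _ _ htj' _ _ _ =>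
    obtain ⟨rfl, rfl⟩ := eq_of_add_single_eq htj htj' h2
    subst h1
    rfl
  case c.d hk _ _ _ _ _ _ _ _ _ _ _ _ _ _ _ _ _ _ => exact absurd h1 (hd hk)
  case d.a => simpa using DFunLike.congr_arg Finsupp.degree h2
  case d.b hk _ _ _ _ => exact absurd h1.symm (hd hk)
  case d.c hk _ _ _ _ _ _ => exact absurd h1.symm (hd hk)
  case d.d i k hk j l hjl t htl _ _ _ _ i' k' hk' j' l' hjl' t' htl' _ _ _ _ =>
    have hi : i = i' := by
      have h3 := DFunLike.congr_fun h1 i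
      have h4 := hk' i
      rw [Finsupp.add_apply, Finsupp.single_eq_same, Finsupp.add_apply,
        Finsupp.single_apply] at h3
      split_ifs at h3 with h5
      · exact h5.symm
      · omega
    subst hi
    obtain rfl := add_right_cancel h1
    have aux : ∀ {t : ℕ →₀ ℕ} {j l : ℕ}, j ≤ l → (∀ i, i < l → t i = 0) →
        ∀ i, i < j → (t + Finsupp.single l 1 : ℕ →₀ ℕ) i = 0 := by
      intro t j l hjl htl i hij
      rw [Finsupp.add_apply, htl i (by omega), Finsupp.single_eq_of_ne (by omega), add_zero]
    rw [add_right_comm t, add_right_comm t'] at h2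
    obtain ⟨rfl, h3⟩ := eq_of_add_single_eq (aux hjl htl) (aux hjl' htl') h2
    obtain ⟨rfl, rfl⟩ := eq_of_add_single_eq htl htl' h3
    rfl

/-- Splitting off the variable of smallest index. -/
theorem exists_eq_add_single_min {s : ℕ →₀ ℕ} (hs : s ≠ 0) :
    ∃ t j, s = t + Finsupp.single j 1 ∧ ∀ i, i < j → t i = 0 := by
  classical
  have hne := Finsupp.support_nonempty_iff.2 hs
  have hj := s.support.min'_mem hne
  obtain ⟨t, ht⟩ := exists_eq_add_single
    (Nat.one_le_iff_ne_zero.2 (Finsupp.mem_support_iff.1 hj))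
  refine ⟨t, _, ht, fun i hi => ?_⟩
  by_contra hti
  have : i ∈ s.support := by
    rw [Finsupp.mem_support_iff, ht, Finsupp.add_apply]
    omega
  exact absurd (s.support.min'_le i this) (not_le.2 hi)

theorem BasisIndex.exists_exps_eq {p : (ℕ →₀ ℕ) × (ℕ →₀ ℕ)}
    (hp : p ∈ reducedExps q) : ∃ x : BasisIndex q, x.exps = p := by
  classical
  obtain ⟨k, s⟩ := p
  obtain ⟨hk, hs, ho⟩ := hp
  dsimp only at hk hs ho
  rcases Nat.even_or_odd s.degree with he | hodd
  · rcases eq_or_ne s 0 with rfl | hs0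
    · exact ⟨.a k hk, rfl⟩
    by_cases hkq : ∀ i, k i < q
    · exact ⟨.b k hkq s hs
        (Nat.pos_of_ne_zero fun h0 => hs0 (Finsupp.degree_eq_zero_iff _ |>.1 h0)) he, rfl⟩
    push Not at hkq
    obtain ⟨i, hi⟩ := hkq
    obtain ⟨s', j, rfl, hj⟩ := exists_eq_add_single_min hs0
    rw [map_add, Finsupp.degree_single, Nat.even_add_one, Nat.not_even_iff_odd] at he
    have hs'0 : s' ≠ 0 := by
      rintro rfl
      simp at he
    obtain ⟨t, l, rfl, hl⟩ := exists_eq_add_single_min hs'0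
    rw [map_add, Finsupp.degree_single, Nat.odd_add_one, Nat.not_odd_iff_even] at he
    have hjl : j ≤ l := by
      by_contra! hlt
      simpa using hj l hlt
    have hkL := hk
    obtain ⟨k', rfl⟩ := exists_eq_add_single hi
    refine ⟨.d i k' (fun m => ?_) j l hjl t hl (fun m => ?_) (fun hlt => ?_) (fun heq => ?_) he,
      ?_⟩
    · have h1 := hkL.1 i
      have h2 := hkL.2 i hi m
      simp only [Finsupp.add_apply, Finsupp.single_apply] at h1 h2
      by_cases hm : m = i
      · subst hm; simp at h1; omega
      · have := h2 hm
        omega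
    · have := hs m
      simp only [Finsupp.add_apply] at this
      omega
    · have := hs l
      simp only [Finsupp.add_apply, Finsupp.single_apply] at this
      simp at this
      omega
    · have := hs l
      subst heq
      simp at this
      omega
    · simp only [exps]
      rw [add_right_comm]
  · have hs0 : s ≠ 0 := by
      rintro rfl
      simp at hodd
    obtain ⟨t, j, rfl, hj⟩ := exists_eq_add_single_min hs0
    rw [map_add, Finsupp.degree_single, Nat.odd_add_one, Nat.not_odd_iff_even] at hodd
    refine ⟨.c k (ho ?_) j t hj ?_ (fun m => ?_) hodd, rfl⟩
    · rw [map_add, Finsupp.degree_single]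
      exact hodd.add_one
    · simpa using hs j
    · have := hs m
      simp only [Finsupp.add_apply] at this
      omega

end Index

/-! ### Substitutions and the quotient by a `T_{ℤ₂}`-ideal -/

section Substitution

variable {K : Type*} [Field K]

theorem lift_mem_of_mem_component {A : Type*} [NonAssocCommRing A] [IsCommJordan A] [Module K A]
    [IsScalarTower K A A] [SMulCommClass K A A] {C : ZMod 2 → Submodule K A} (h1 : (1 : A) ∈ C 0)
    (hmul : ∀ i j a b, a ∈ C i → b ∈ C j → a * b ∈ C (i + j)) {v : Var → A}
    (hy : ∀ i, v (.y i) ∈ C 0) (hz : ∀ i, v (.z i) ∈ C 1) {i : ZMod 2} {f : J K}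
    (hf : f ∈ J.component K i) : J.lift v f ∈ C i := by
  refine Submodule.span_induction (p := fun f _ => J.lift v f ∈ C i) ?_ ?_ ?_ ?_ hf
  · clear hf
    intro u hu
    induction hu with
    | one => rw [J.lift_one]; exact h1
    | y i => rw [y, J.lift_var]; exact hy i
    | z i => rw [z, J.lift_var]; exact hz i
    | mul hu hv ihu ihv =>
      rw [map_mul]
      exact hmul _ _ _ _ ihu ihv
  · rw [map_zero]; exact (C i).zero_mem
  · intro a b _ _ ha hb
    rw [map_add]; exact (C i).add_mem ha hb
  · intro c a _ ha
    rw [map_smul]; exact (C i).smul_mem c ha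

theorem one_mem_component : (1 : J K) ∈ J.component K 0 := Submodule.subset_span .one

theorem y_mem_component (i : ℕ) : y K i ∈ J.component K 0 := Submodule.subset_span (.y i)

theorem z_mem_component (i : ℕ) : z K i ∈ J.component K 1 := Submodule.subset_span (.z i)

theorem mul_mem_component (i j : ZMod 2) (f g : J K) (hf : f ∈ J.component K i)
    (hg : g ∈ J.component K j) : f * g ∈ J.component K (i + j) := by
  have hfg := Submodule.apply_mem_map₂ (LinearMap.mul K (J K)) hf hg
  rw [J.component, J.component, Submodule.map₂_span_span] at hfg
  refine Submodule.span_mono ?_ hfg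
  rintro _ ⟨u, hu, v, hv, rfl⟩
  exact .mul hu hv

/-- The substitution `y_i ↦ Y i`, `z_i ↦ Z i`. -/
def substHom (Y Z : ℕ → J K) : J K →ₙₐ[K] J K :=
  J.lift fun
    | .y i => Y i
    | .z i => Z i

theorem substHom_y (Y Z : ℕ → J K) (i : ℕ) : substHom Y Z (y K i) = Y i := J.lift_var _ _

theorem substHom_z (Y Z : ℕ → J K) (i : ℕ) : substHom Y Z (z K i) = Z i := J.lift_var _ _

theorem substHom_one (Y Z : ℕ → J K) : substHom Y Z 1 = 1 := J.lift_one _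

theorem isGradedEnd_substHom {Y Z : ℕ → J K} (hY : ∀ i, Y i ∈ J.component K 0)
    (hZ : ∀ i, Z i ∈ J.component K 1) : IsGradedEnd (substHom Y Z) :=
  ⟨substHom_one Y Z, fun _ _ hf =>
    lift_mem_of_mem_component one_mem_component mul_mem_component hY hZ hf⟩

theorem map_lprod {A B : Type*} [NonAssocRing A] [NonAssocRing B] [Module K A] [Module K B]
    (φ : A →ₙₐ[K] B) (h1 : φ 1 = 1) (l : List A) : φ (lprod l) = lprod (l.map φ) := by
  rw [lprod, lprod, ← h1]
  generalize (1 : A) = a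
  induction l generalizing a with
  | nil => rfl
  | cons b l ih => rw [List.foldl_cons, ih, List.map_cons, List.foldl_cons, map_mul]

theorem map_lpow {A B : Type*} [NonAssocRing A] [NonAssocRing B] [Module K A] [Module K B]
    (φ : A →ₙₐ[K] B) (h1 : φ 1 = 1) (a : A) (n : ℕ) : φ (lpow a n) = lpow (φ a) n := by
  rw [lpow, lpow, map_lprod φ h1, List.map_replicate]

theorem map_lmono {A B : Type*} [NonAssocRing A] [NonAssocRing B] [Module K A] [Module K B]
    (φ : A →ₙₐ[K] B) (h1 : φ 1 = 1) (v : ℕ → A) (k : ℕ →₀ ℕ) :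
    φ (lmono v k) = lmono (φ ∘ v) k := by
  rw [lmono, lmono, map_lprod φ h1, List.map_map]

theorem map_leftPow {B : Type*} [NonAssocRing B] [Module K B]
    (φ : J K →ₙₐ[K] B) (h1 : φ 1 = 1) (f : J K) (n : ℕ) : φ (leftPow f n) = lpow (φ f) n :=
  map_lpow φ h1 f n

theorem map_mono {B : Type*} [NonAssocRing B] [Module K B]
    (φ : J K →ₙₐ[K] B) (h1 : φ 1 = 1) (v : ℕ → J K) (k : ℕ →₀ ℕ) :
    φ (mono v k) = lmono (φ ∘ v) k :=
  map_lmono φ h1 v k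

theorem map_associator {A B : Type*} [NonAssocRing A] [NonAssocRing B] [Module K A] [Module K B]
    (φ : A →ₙₐ[K] B) (a b c : A) :
    φ (associator a b c) = associator (φ a) (φ b) (φ c) := by
  simp only [associator_apply, map_sub, map_mul]

/-- The value of a basis monomial in an algebra that satisfies the identities is the value of its
normal form. -/
theorem map_basisElem [NeZero (2 : K)] {A : Type*} [NonAssocCommRing A] [IsCommJordan A]
    [Module K A] {q : ℕ} {E O : Submodule K A} (h : SatisfiesIdentities q E O) (φ : J K →ₙₐ[K] A)
    (h1 : φ 1 = 1) (hY : ∀ i, φ (y K i) ∈ E) (hZ : ∀ i, φ (z K i) ∈ O) (hq : (q : K) = 0)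
    (hq0 : q ≠ 0) (x : BasisIndex q) :
    φ (basisElem K x) = normalMono (φ ∘ y K) (φ ∘ z K) x.exps := by
  cases x with
  | a k hk => rw [basisElem, map_mono φ h1, BasisIndex.exps, normalMono, lmono_zero, mul_one]
  | b k hk t ht ht₀ hte =>
    rw [basisElem, map_mul, map_mono φ h1, map_mono φ h1, BasisIndex.exps, normalMono]
  | c k hk j t htj htj' ht hte =>
    rw [basisElem, map_mul, map_mul, map_mono φ h1, map_mono φ h1, BasisIndex.exps]
    exact h.mul_odd_mul_lmono (Y := φ ∘ y K) (Z := φ ∘ z K) hY hZ k t j hte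
  | d i k hk j l hjl t htl ht hlt heq hte =>
    rw [basisElem, map_mul, map_mul, map_mul, map_mul, map_mono φ h1, map_mono φ h1,
      BasisIndex.exps]
    exact h.mul_odd_mul_odd_mul_lmono (Y := φ ∘ y K) (Z := φ ∘ z K) hY hZ hq hq0 k t i j l hte

end Substitution

section Quotient

variable {K : Type*} [Field K] {I : Submodule K (J K)}

/-- Congruence modulo a `T_{ℤ₂}`-ideal. -/
def IsTIdeal.ringCon (hI : IsTIdeal I) : RingCon (J K) where
  r a b := a - b ∈ I
  iseqv :=
    { refl := fun a => by rw [sub_self]; exact I.zero_mem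
      symm := fun h => by rw [← neg_sub]; exact I.neg_mem h
      trans := fun h h' => by rw [← sub_add_sub_cancel]; exact I.add_mem h h' }
  add' h h' := by rw [add_sub_add_comm]; exact I.add_mem h h'
  mul' {a b c d} h h' := by
    have : a * c - b * d = (a - b) * c + b * (c - d) := by rw [sub_mul, mul_sub]; abel
    rw [this]
    exact I.add_mem (hI.mul_right _ _ h) (hI.mul_left _ _ h')

/-- The quotient of `J(X)` by a `T_{ℤ₂}`-ideal, as an algebra. -/
def RelFree (hI : IsTIdeal I) : Type _ := hI.ringCon.Quotient

variable (hI : IsTIdeal I)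

instance : NonAssocCommRing (RelFree hI) :=
  { (inferInstance : NonAssocRing hI.ringCon.Quotient) with
    mul_comm := by
      rintro ⟨a⟩ ⟨b⟩
      exact congrArg (RingCon.toQuotient (c := hI.ringCon)) (mul_comm a b) }

instance : Module K (RelFree hI) :=
  { (inferInstance : DistribMulAction K hI.ringCon.Quotient) with
    add_smul := by
      rintro c d ⟨a⟩
      exact congrArg (RingCon.toQuotient (c := hI.ringCon)) (add_smul c d a)
    zero_smul := by
      rintro ⟨a⟩
      exact congrArg (RingCon.toQuotient (c := hI.ringCon)) (zero_smul K a) }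

instance : IsScalarTower K (RelFree hI) (RelFree hI) where
  smul_assoc := by
    rintro c ⟨a⟩ ⟨b⟩
    exact congrArg (RingCon.toQuotient (c := hI.ringCon)) (smul_mul_assoc c a b)

instance : SMulCommClass K (RelFree hI) (RelFree hI) where
  smul_comm := by
    rintro c ⟨a⟩ ⟨b⟩
    exact congrArg (RingCon.toQuotient (c := hI.ringCon)) (mul_smul_comm c a b).symm

instance : IsCommJordan (RelFree hI) where
  lmul_comm_rmul_rmul := by
    rintro ⟨a⟩ ⟨b⟩
    exact congrArg (RingCon.toQuotient (c := hI.ringCon))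
      (IsCommJordan.lmul_comm_rmul_rmul a b)

/-- The projection of `J(X)` onto its quotient by a `T_{ℤ₂}`-ideal. -/
def RelFree.mk : J K →ₙₐ[K] RelFree hI where
  toFun a := RingCon.toQuotient (c := hI.ringCon) a
  map_smul' _ _ := rfl
  map_zero' := rfl
  map_add' _ _ := rfl
  map_mul' _ _ := rfl

theorem RelFree.mk_one : RelFree.mk hI 1 = 1 := rfl

theorem RelFree.mk_eq_mk_iff {a b : J K} : RelFree.mk hI a = RelFree.mk hI b ↔ a - b ∈ I :=
  RingCon.eq hI.ringCon

theorem RelFree.mk_eq_zero_iff {a : J K} : RelFree.mk hI a = 0 ↔ a ∈ I := by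
  rw [← map_zero (RelFree.mk hI), RelFree.mk_eq_mk_iff, sub_zero]

/-- The image in the quotient of a homogeneous component of `J(X)`. -/
def RelFree.component (i : ZMod 2) : Submodule K (RelFree hI) :=
  (J.component K i).map (RelFree.mk hI : J K →ₗ[K] RelFree hI)

theorem RelFree.mk_mem_component {i : ZMod 2} {f : J K} (hf : f ∈ J.component K i) :
    RelFree.mk hI f ∈ RelFree.component hI i := ⟨f, hf, rfl⟩

theorem RelFree.exists_mk_eq {i : ZMod 2} {a : RelFree hI} (ha : a ∈ RelFree.component hI i) :
    ∃ f ∈ J.component K i, RelFree.mk hI f = a := ha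

theorem RelFree.mul_mem_component {i j : ZMod 2} {a b : RelFree hI}
    (ha : a ∈ RelFree.component hI i) (hb : b ∈ RelFree.component hI j) :
    a * b ∈ RelFree.component hI (i + j) := by
  obtain ⟨f, hf, rfl⟩ := RelFree.exists_mk_eq hI ha
  obtain ⟨g, hg, rfl⟩ := RelFree.exists_mk_eq hI hb
  rw [← map_mul]
  exact RelFree.mk_mem_component hI (GradedUJ.mul_mem_component _ _ _ _ hf hg)

/-- An element of a `T_{ℤ₂}`-ideal vanishes in the quotient under every graded substitution. -/
theorem RelFree.mk_substHom_eq_zero {Y Z : ℕ → J K} (hY : ∀ i, Y i ∈ J.component K 0)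
    (hZ : ∀ i, Z i ∈ J.component K 1) {f : J K} (hf : f ∈ I) :
    RelFree.mk hI (substHom Y Z f) = 0 :=
  (RelFree.mk_eq_zero_iff hI).2 (hI.map_mem _ (isGradedEnd_substHom hY hZ) f hf)

theorem RelFree.satisfiesIdentities {q : ℕ} (hgen : generators K q ⊆ I) :
    SatisfiesIdentities q (RelFree.component hI 0) (RelFree.component hI 1) := by
  simp only [generators, Set.insert_subset_iff, Set.singleton_subset_iff, SetLike.mem_coe] at hgen
  obtain ⟨g1, g2, g3, g4, g5, g6, g7, g8⟩ := hgen
  -- Each identity is the image of a generator under the substitution of the given elements for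
  -- the variables of indices `1, 2, 3, 4`.
  have hseq : ∀ {i : ZMod 2} {a b c d : J K}, a ∈ J.component K i → b ∈ J.component K i →
      c ∈ J.component K i → d ∈ J.component K i → ∀ n : ℕ,
      (match n with | 1 => a | 2 => b | 3 => c | _ => d) ∈ J.component K i := by
    intro i a b c d ha hb hc hd n
    split <;> assumption
  have hy0 := y_mem_component (K := K) 0
  have hz0 := z_mem_component (K := K) 0
  refine ⟨RelFree.mk_mem_component hI one_mem_component, RelFree.mul_mem_component hI,
    RelFree.mul_mem_component hI, RelFree.mul_mem_component hI, ?_, ?_, ?_, ?_, ?_, ?_, ?_, ?_⟩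
  · rintro _ _ _ ⟨a, ha, rfl⟩ ⟨b, hb, rfl⟩ ⟨c, hc, rfl⟩
    have := RelFree.mk_substHom_eq_zero hI (hseq ha hb hc hc) (fun _ => hz0) g1
    rw [map_associator, map_associator] at this
    simp only [substHom_y] at this
    exact sub_eq_zero.1 this
  · rintro _ _ _ ⟨u, hu, rfl⟩ ⟨a, ha, rfl⟩ ⟨b, hb, rfl⟩
    have := RelFree.mk_substHom_eq_zero hI (hseq ha hb hb hb) (fun _ => hu) g2
    rw [map_associator, map_associator] at this
    simp only [substHom_y, substHom_z] at this
    exact sub_eq_zero.1 this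
  · rintro _ _ _ ⟨u, hu, rfl⟩ ⟨a, ha, rfl⟩ ⟨v, hv, rfl⟩
    have := RelFree.mk_substHom_eq_zero hI (fun _ => ha) (hseq hu hv hv hv) g3
    rw [map_associator, map_associator] at this
    simp only [substHom_y, substHom_z] at this
    exact sub_eq_zero.1 this
  · rintro _ _ _ ⟨u, hu, rfl⟩ ⟨v, hv, rfl⟩ ⟨w, hw, rfl⟩
    have := RelFree.mk_substHom_eq_zero hI (fun _ => hy0) (hseq hu hv hw hw) g4
    rw [map_associator, map_associator] at this
    simp only [substHom_z] at this
    exact sub_eq_zero.1 this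
  · rintro _ _ _ _ ⟨u, hu, rfl⟩ ⟨v, hv, rfl⟩ ⟨w, hw, rfl⟩ ⟨x, hx, rfl⟩
    have := RelFree.mk_substHom_eq_zero hI (fun _ => hy0) (hseq hu hv hw hx) g5
    rw [map_associator, map_associator, map_mul, map_mul] at this
    simp only [substHom_z] at this
    exact sub_eq_zero.1 this
  · rintro _ _ ⟨a, ha, rfl⟩ ⟨b, hb, rfl⟩
    have := RelFree.mk_substHom_eq_zero hI (hseq ha hb hb hb) (fun _ => hz0) g6
    rw [map_mul, map_mul, map_sub, map_sub, map_sub, map_sub, map_leftPow _ (substHom_one _ _),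
      map_leftPow _ (substHom_one _ _), map_lpow _ (RelFree.mk_one hI),
      map_lpow _ (RelFree.mk_one hI)] at this
    simp only [substHom_y] at this
    exact this
  · rintro _ ⟨u, hu, rfl⟩
    have := RelFree.mk_substHom_eq_zero hI (fun _ => hy0) (fun _ => hu) g7
    rw [map_sub, map_sub, map_leftPow _ (substHom_one _ _), map_lpow _ (RelFree.mk_one hI)] at this
    simp only [substHom_z] at this
    exact sub_eq_zero.1 this
  · rintro _ _ ⟨a, ha, rfl⟩ ⟨u, hu, rfl⟩
    have := RelFree.mk_substHom_eq_zero hI (fun _ => ha) (fun _ => hu) g8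
    rw [map_mul, map_mul, map_sub, map_sub, map_leftPow _ (substHom_one _ _),
      map_lpow _ (RelFree.mk_one hI)] at this
    simp only [substHom_y, substHom_z] at this
    exact this

theorem RelFree.mk_y_mem (i : ℕ) : (RelFree.mk hI ∘ y K) i ∈ RelFree.component hI 0 :=
  RelFree.mk_mem_component hI (y_mem_component i)

theorem RelFree.mk_z_mem (i : ℕ) : (RelFree.mk hI ∘ z K) i ∈ RelFree.component hI 1 :=
  RelFree.mk_mem_component hI (z_mem_component i)

/-- The normal forms span the quotient, as they contain the generators and are closed under
products. -/
theorem RelFree.mk_mem_span_normalMono [NeZero (2 : K)] {q : ℕ} (hgen : generators K q ⊆ I)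
    (hq : (q : K) = 0) (hq0 : q ≠ 0) (f : J K) :
    RelFree.mk hI f ∈ Submodule.span K
      (Set.range (normalMono (RelFree.mk hI ∘ y K) (RelFree.mk hI ∘ z K))) := by
  have h := RelFree.satisfiesIdentities hI hgen
  have hY := RelFree.mk_y_mem hI
  have hZ := RelFree.mk_z_mem hI
  obtain ⟨a, rfl⟩ := J.mk_surjective K f
  induction a using MonoidAlgebra.induction_linear with
  | zero => rw [map_zero, map_zero]; exact Submodule.zero_mem _
  | add a b iha ihb => rw [map_add, map_add]; exact Submodule.add_mem _ iha ihb
  | single m r =>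
    rw [← mul_one r, ← smul_eq_mul, ← MonoidAlgebra.smul_single, map_smul, map_smul]
    refine Submodule.smul_mem _ r ?_
    cases m with
    | one =>
      refine Submodule.subset_span ⟨(0, 0), ?_⟩
      rw [normalMono, lmono_zero, lmono_zero, mul_one]
      rfl
    | coe m =>
      induction m using FreeMagma.rec with
      | of x =>
        cases x with
        | y i =>
          refine Submodule.subset_span ⟨(Finsupp.single i 1, 0), ?_⟩
          rw [normalMono, lmono_zero, mul_one, h.lmono_even_single hY, lpow_succ, lpow_zero,
            one_mul]
          rfl
        | z i =>
          refine Submodule.subset_span ⟨(0, Finsupp.single i 1), ?_⟩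
          rw [normalMono, lmono_zero, one_mul, h.lmono_odd_single hZ, lpow_succ, lpow_zero,
            one_mul]
          rfl
      | mul a b iha ihb =>
        have : (MonoidAlgebra.single ((a * b : FreeMagma Var) : WithOne (FreeMagma Var)) 1 :
            FreeNonassoc K) = MonoidAlgebra.single (a : WithOne (FreeMagma Var)) 1 *
              MonoidAlgebra.single (b : WithOne (FreeMagma Var)) 1 := by
          rw [MonoidAlgebra.single_mul_single, mul_one, WithOne.coe_mul]
        have hmk : ∀ a b : FreeNonassoc K, RelFree.mk hI (J.mk K (a * b)) =
            RelFree.mk hI (J.mk K a) * RelFree.mk hI (J.mk K b) := fun _ _ => rfl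
        change RelFree.mk hI (J.mk K (MonoidAlgebra.single
          ((a * b : FreeMagma Var) : WithOne (FreeMagma Var)) 1)) ∈ _
        rw [this, hmk]
        exact h.mul_mem_span_normalMono hY hZ hq hq0 iha ihb

/-- Every element of `J(X)` is congruent modulo the identities to a combination of the basis
monomials. -/
theorem exists_sub_mem_of_generators_subset (hI : IsTIdeal I) [NeZero (2 : K)] {q : ℕ}
    (hgen : generators K q ⊆ I) (hq : (q : K) = 0) (hq2 : 2 ≤ q) (f : J K) :
    ∃ g ∈ Submodule.span K (Set.range (basisElem K (q := q))), f - g ∈ I := by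
  have h := RelFree.satisfiesIdentities hI hgen
  have hf := RelFree.mk_mem_span_normalMono hI hgen hq (by omega) f
  have hle : Submodule.span K
      (Set.range (normalMono (RelFree.mk hI ∘ y K) (RelFree.mk hI ∘ z K))) ≤
      (Submodule.span K (Set.range (basisElem K (q := q)))).map
        (RelFree.mk hI : J K →ₗ[K] RelFree hI) := by
    refine Submodule.span_le.2 ?_
    rintro _ ⟨p, rfl⟩
    refine Submodule.span_le.2 ?_ (h.normalMono_mem_span_reduced (RelFree.mk_y_mem hI)
      (RelFree.mk_z_mem hI) hq2 p)
    rintro _ ⟨r, hr, rfl⟩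
    obtain ⟨x, rfl⟩ := BasisIndex.exists_exps_eq hr
    exact ⟨_, Submodule.subset_span ⟨x, rfl⟩, map_basisElem h (RelFree.mk hI) (RelFree.mk_one hI)
      (RelFree.mk_y_mem hI) (RelFree.mk_z_mem hI) hq (by omega) x⟩
  obtain ⟨g, hg, hgf⟩ := hle hf
  exact ⟨g, hg, (RelFree.mk_eq_mk_iff hI).1 hgf.symm⟩

end Quotient

/-! ### The algebra `UJ₂` satisfies the identities -/

section Model

variable {K : Type*} [Field K]

/-- The element `a (e₁₁ + e₂₂) + b e₁₂ + c (e₁₁ - e₂₂)` of `UJ₂`. -/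
def elt (a b c : K) : UJ2 K :=
  SymAlg.sym ⟨!![a + c, b; 0, a - c], by simp [UT2, ← SetLike.mem_coe]⟩

theorem elt_mul [NeZero (2 : K)] (a b c a' b' c' : K) :
    elt a b c * elt a' b' c' = elt (a * a' + c * c') (a * b' + b * a') (a * c' + c * a') := by
  have h2 : (2 : K) ≠ 0 := NeZero.ne _
  apply SymAlg.unsym_injective
  rw [SymAlg.unsym_mul]
  apply Subtype.ext
  change (algebraMap K (Matrix (Fin 2) (Fin 2) K) 2⁻¹) *
    (!![a + c, b; 0, a - c] * !![a' + c', b'; 0, a' - c'] +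
      !![a' + c', b'; 0, a' - c'] * !![a + c, b; 0, a - c]) = !![_, _; _, _]
  rw [← Algebra.smul_def]
  ext i j
  fin_cases i <;> fin_cases j <;> simp <;> field_simp <;> ring

theorem elt_sub (a b c a' b' c' : K) :
    elt a b c - elt a' b' c' = elt (a - a') (b - b') (c - c') := by
  apply SymAlg.unsym_injective
  rw [SymAlg.unsym_sub]
  apply Subtype.ext
  change !![a + c, b; 0, a - c] - !![a' + c', b'; 0, a' - c'] = !![_, _; _, _]
  ext i j
  fin_cases i <;> fin_cases j <;> simp <;> ring

theorem elt_one : (elt 1 0 0 : UJ2 K) = 1 := by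
  apply SymAlg.unsym_injective
  apply Subtype.ext
  change !![(1 : K) + 0, 0; 0, 1 - 0] = 1
  ext i j
  fin_cases i <;> fin_cases j <;> simp

theorem elt_zero : (elt 0 0 0 : UJ2 K) = 0 := by
  apply SymAlg.unsym_injective
  apply Subtype.ext
  change !![(0 : K) + 0, 0; 0, 0 - 0] = 0
  ext i j
  fin_cases i <;> fin_cases j <;> simp

theorem mem_assEven_iff {u : UJ2 K} : u ∈ assEven K ↔ ∃ a b, u = elt a b 0 := by
  rw [assEven, Submodule.mem_span_pair]
  refine exists_congr fun a => exists_congr fun b => ?_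
  rw [eq_comm]
  refine Eq.congr_right ?_
  apply SymAlg.unsym_injective
  apply Subtype.ext
  change a • (!![(1 : K), 0; 0, 0] + !![0, 0; 0, 1]) + b • !![0, 1; 0, 0] =
    !![a + 0, b; 0, a - 0]
  ext i j
  fin_cases i <;> fin_cases j <;> simp

theorem mem_assOdd_iff {u : UJ2 K} : u ∈ assOdd K ↔ ∃ c, u = elt 0 0 c := by
  rw [assOdd, Submodule.mem_span_singleton]
  refine exists_congr fun c => ?_
  rw [eq_comm]
  refine Eq.congr_right ?_
  apply SymAlg.unsym_injective
  apply Subtype.ext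
  change c • (!![(1 : K), 0; 0, 0] - !![0, 0; 0, 1]) = !![0 + c, 0; 0, 0 - c]
  ext i j
  fin_cases i <;> fin_cases j <;> simp

variable [NeZero (2 : K)]

theorem lpow_elt_even (a b : K) (n : ℕ) :
    lpow (elt a b 0) (n + 1) = elt (a ^ (n + 1)) ((n + 1 : ℕ) * a ^ n * b) 0 := by
  induction n with
  | zero => rw [lpow_succ, lpow_zero, one_mul]; simp
  | succ n ih =>
    rw [lpow_succ, ih, elt_mul]
    congr 1
    · ring
    · push_cast; ring
    · ring

theorem lpow_elt_odd (c : K) (n : ℕ) :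
    lpow (elt 0 0 c) (2 * n + 1) = elt 0 0 (c ^ (2 * n + 1)) := by
  induction n with
  | zero => rw [mul_zero, lpow_succ, lpow_zero, one_mul]; simp
  | succ n ih =>
    rw [show 2 * (n + 1) + 1 = 2 * n + 1 + 1 + 1 by ring, lpow_succ, lpow_succ, ih, elt_mul,
      elt_mul]
    congr 1 <;> ring

theorem satisfiesIdentities_UJ2 {q : ℕ} (hq : (q : K) = 0) (hodd : Odd q)
    (hpow : ∀ a : K, a ^ q = a) : SatisfiesIdentities q (assEven K) (assOdd K) := by
  -- The derivative of `a^q` vanishes, so `y^q - y` is a multiple of `e₁₂` for even `y`.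
  have hfrob : ∀ a b : K, lpow (elt a b 0) q - elt a b 0 = elt 0 (-b) 0 := by
    intro a b
    obtain ⟨n, rfl⟩ := Nat.exists_eq_succ_of_ne_zero hodd.pos.ne'
    rw [Nat.succ_eq_add_one] at *
    rw [lpow_elt_even, elt_sub, hpow, hq]
    congr 1 <;> ring
  constructor
  · exact mem_assEven_iff.2 ⟨1, 0, elt_one.symm⟩
  all_goals simp only [mem_assEven_iff, mem_assOdd_iff]
  · rintro _ _ ⟨a, b, rfl⟩ ⟨a', b', rfl⟩
    exact ⟨a * a', a * b' + b * a', by rw [elt_mul]; congr 1 <;> ring⟩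
  · rintro _ _ ⟨a, b, rfl⟩ ⟨c, rfl⟩
    exact ⟨a * c, by rw [elt_mul]; congr 1 <;> ring⟩
  · rintro _ _ ⟨c, rfl⟩ ⟨c', rfl⟩
    exact ⟨c * c', 0, by rw [elt_mul]; congr 1 <;> ring⟩
  · rintro _ _ _ ⟨a, b, rfl⟩ ⟨a', b', rfl⟩ ⟨a'', b'', rfl⟩
    simp only [elt_mul]
    congr 1 <;> ring
  · rintro _ _ _ ⟨c, rfl⟩ ⟨a, b, rfl⟩ ⟨a', b', rfl⟩
    simp only [elt_mul]
    congr 1 <;> ring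
  · rintro _ _ _ ⟨c, rfl⟩ ⟨a, b, rfl⟩ ⟨c', rfl⟩
    simp only [elt_mul]
    congr 1 <;> ring
  · rintro _ _ _ ⟨c, rfl⟩ ⟨c', rfl⟩ ⟨c'', rfl⟩
    simp only [elt_mul]
    congr 1 <;> ring
  · rintro _ _ _ _ ⟨c, rfl⟩ ⟨c', rfl⟩ ⟨c'', rfl⟩ ⟨c₃, rfl⟩
    simp only [elt_mul]
    congr 1 <;> ring
  · rintro _ _ ⟨a, b, rfl⟩ ⟨a', b', rfl⟩
    rw [hfrob, hfrob, elt_mul, ← elt_zero]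
    congr 1 <;> ring
  · rintro _ ⟨c, rfl⟩
    obtain ⟨n, rfl⟩ := hodd
    rw [lpow_elt_odd, hpow]
  · rintro _ _ ⟨a, b, rfl⟩ ⟨c, rfl⟩
    rw [hfrob, elt_mul, ← elt_zero]
    congr 1 <;> ring

theorem eval_one (Y Z : ℕ → UJ2 K) : eval Y Z 1 = 1 := J.lift_one _

theorem eval_y (Y Z : ℕ → UJ2 K) (i : ℕ) : eval Y Z (y K i) = Y i := J.lift_var _ _

theorem eval_z (Y Z : ℕ → UJ2 K) (i : ℕ) : eval Y Z (z K i) = Z i := J.lift_var _ _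

theorem SatisfiesIdentities.generators_subset_TAss {q : ℕ}
    (h : SatisfiesIdentities q (assEven K) (assOdd K)) : generators K q ⊆ TAss K := by
  simp only [generators, Set.insert_subset_iff, Set.singleton_subset_iff, SetLike.mem_coe]
  refine ⟨fun Y Z hY hZ => ?_, fun Y Z hY hZ => ?_, fun Y Z hY hZ => ?_, fun Y Z hY hZ => ?_,
    fun Y Z hY hZ => ?_, fun Y Z hY hZ => ?_, fun Y Z hY hZ => ?_, fun Y Z hY hZ => ?_⟩ <;>
  simp only [map_sub, map_mul, map_leftPow _ (eval_one Y Z), eval_y, eval_z,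
    associator_apply]
  · exact sub_eq_zero.2 (h.assoc_eee (hY _) (hY _) (hY _))
  · exact sub_eq_zero.2 (h.assoc_oee (hZ _) (hY _) (hY _))
  · exact sub_eq_zero.2 (h.assoc_oeo (hZ _) (hY _) (hZ _))
  · exact sub_eq_zero.2 (h.assoc_ooo (hZ _) (hZ _) (hZ _))
  · exact sub_eq_zero.2 (h.assoc_oo_o_o (hZ _) (hZ _) (hZ _) (hZ _))
  · exact h.frob_mul_frob (hY _) (hY _)
  · exact sub_eq_zero.2 (h.lpow_odd (hZ _))
  · exact h.frob_mul_odd (hY _) (hZ _)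

/-- The graded identities of `UJ₂` form a `T_{ℤ₂}`-ideal, since evaluations respect the
grading. -/
theorem SatisfiesIdentities.isTIdeal_TAss {q : ℕ}
    (h : SatisfiesIdentities q (assEven K) (assOdd K)) : IsTIdeal (TAss K) where
  mul_left g f hf Y Z hY hZ := by rw [map_mul, hf Y Z hY hZ, mul_zero]
  mul_right g f hf Y Z hY hZ := by rw [map_mul, hf Y Z hY hZ, zero_mul]
  map_mem φ hφ f hf Y Z hY hZ := by
    let C : ZMod 2 → Submodule K (UJ2 K) := fun i => if i = 0 then assEven K else assOdd K
    have hmem : ∀ {i : ZMod 2} {g : J K}, g ∈ J.component K i → eval Y Z g ∈ C i := by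
      refine lift_mem_of_mem_component (C := C) h.one_mem ?_ hY hZ
      intro i j
      have h10 : (1 : ZMod 2) ≠ 0 := by decide
      have h11 : (1 + 1 : ZMod 2) = 0 := by decide
      have hcases : ∀ i : ZMod 2, i = 0 ∨ i = 1 := by decide
      rcases hcases i with rfl | rfl <;> rcases hcases j with rfl | rfl <;> intro a b
      · exact h.mul_ee
      · exact h.mul_eo
      · exact h.mul_oe
      · rw [h11]; exact h.mul_oo
    have hcomp : (eval Y Z).comp φ =
        eval (fun i => eval Y Z (φ (y K i))) (fun i => eval Y Z (φ (z K i))) := by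
      refine J.hom_ext ?_ ?_
      · rw [NonUnitalAlgHom.comp_apply, hφ.1, eval_one, eval_one]
      · rintro (i | i)
        · exact (eval_y (fun i => eval Y Z (φ (y K i))) (fun i => eval Y Z (φ (z K i))) i).symm
        · exact (eval_z (fun i => eval Y Z (φ (y K i))) (fun i => eval Y Z (φ (z K i))) i).symm
    have := hf _ _ (fun i => hmem (hφ.2 0 _ (y_mem_component i)))
      (fun i => hmem (hφ.2 1 _ (z_mem_component i)))
    rw [← hcomp] at this
    exact this

end Model

/-! ### Linear independence -/

section Independence

variable {K : Type*} [Field K]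

open Polynomial

/-- The value `a^k = ∏ a_j^{k_j}` of a commutative monomial. -/
def evalExp {R : Type*} [CommMonoid R] (a : ℕ → R) (k : ℕ →₀ ℕ) : R :=
  k.prod fun j n => a j ^ n

theorem evalExp_zero {R : Type*} [CommMonoid R] (a : ℕ → R) : evalExp a 0 = 1 :=
  Finsupp.prod_zero_index

theorem evalExp_add_single {R : Type*} [CommMonoid R] (a : ℕ → R) (k : ℕ →₀ ℕ) (i : ℕ) :
    evalExp a (k + Finsupp.single i 1) = evalExp a k * a i := by
  rw [evalExp, Finsupp.prod_add_index' (fun _ => pow_zero _) (fun _ _ _ => pow_add _ _ _),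
    Finsupp.prod_single_index (h := fun j n => a j ^ n) (pow_zero _), pow_one]
  rfl

/-- The multiplicative character `(a, c) ↦ a^k c^s` of the monoid `K^ℕ × K^ℕ`. -/
def expHom (K : Type*) [Field K] (p : (ℕ →₀ ℕ) × (ℕ →₀ ℕ)) : (ℕ → K) × (ℕ → K) →* K where
  toFun x := evalExp x.1 p.1 * evalExp x.2 p.2
  map_one' := by simp [evalExp, Finsupp.prod]
  map_mul' x x' := by
    simp only [evalExp, Finsupp.prod, Prod.fst_mul, Prod.snd_mul, Pi.mul_apply, mul_pow,
      Finset.prod_mul_distrib]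
    ring

theorem expHom_apply (p : (ℕ →₀ ℕ) × (ℕ →₀ ℕ)) (x : (ℕ → K) × (ℕ → K)) :
    expHom K p x = evalExp x.1 p.1 * evalExp x.2 p.2 := rfl

theorem evalExp_one (k : ℕ →₀ ℕ) : evalExp (1 : ℕ → K) k = 1 := by simp [evalExp, Finsupp.prod]

theorem evalExp_update_one (k : ℕ →₀ ℕ) (i : ℕ) (a : K) :
    evalExp (Function.update 1 i a) k = a ^ k i := by
  rw [evalExp, Finsupp.prod, Finset.prod_eq_single i]
  · simp
  · intro j _ hj
    simp [Function.update_of_ne hj]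
  · intro hi
    rw [Finsupp.notMem_support_iff.1 hi, pow_zero]

section Finite

variable [Fintype K]

theorem eq_of_forall_pow_eq {m n : ℕ} (hm : m < Fintype.card K) (hn : n < Fintype.card K)
    (h : ∀ a : K, a ^ m = a ^ n) : m = n := by
  have h0 : (X ^ m - X ^ n : K[X]) = 0 := by
    refine Polynomial.eq_zero_of_natDegree_lt_card_of_eval_eq_zero _ (f := (id : K → K))
      Function.injective_id (fun a => ?_) ?_
    · simp [h a]
    · refine (natDegree_sub_le _ _).trans_lt ?_
      rw [natDegree_X_pow, natDegree_X_pow]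
      exact max_lt hm hn
  simpa using congrArg natDegree (sub_eq_zero.1 h0)

theorem expHom_injOn : Set.InjOn (expHom K)
    {p | (∀ i, p.1 i < Fintype.card K) ∧ ∀ j, p.2 j < Fintype.card K} := by
  rintro ⟨k, s⟩ ⟨hk, hs⟩ ⟨k', s'⟩ ⟨hk', hs'⟩ h
  ext i
  · refine eq_of_forall_pow_eq (hk i) (hk' i) fun a => ?_
    have := DFunLike.congr_fun h (Function.update (1 : ℕ → K) i a, 1)
    simpa only [expHom_apply, evalExp_one, evalExp_update_one, mul_one] using this
  · refine eq_of_forall_pow_eq (hs i) (hs' i) fun a => ?_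
    have := DFunLike.congr_fun h (1, Function.update (1 : ℕ → K) i a)
    simpa only [expHom_apply, evalExp_one, evalExp_update_one, one_mul] using this

/-- Distinct monomials with all exponents `< q` are linearly independent as functions on
`K^ℕ × K^ℕ`, by Dedekind's theorem on characters. -/
theorem eq_zero_of_sum_evalExp_eq_zero {ι : Type*} {S : Finset ι}
    {e : ι → (ℕ →₀ ℕ) × (ℕ →₀ ℕ)} (he : Set.InjOn e S)
    (h1 : ∀ x ∈ S, ∀ i, (e x).1 i < Fintype.card K) (h2 : ∀ x ∈ S, ∀ j, (e x).2 j < Fintype.card K)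
    {g : ι → K} (h : ∀ a c : ℕ → K, ∑ x ∈ S, g x * (evalExp a (e x).1 * evalExp c (e x).2) = 0) :
    ∀ x ∈ S, g x = 0 := by
  have hinj : Function.Injective fun x : S => expHom K (e x) := fun x x' hxx =>
    Subtype.ext (he x.2 x'.2 (expHom_injOn ⟨h1 x x.2, h2 x x.2⟩ ⟨h1 x' x'.2, h2 x' x'.2⟩ hxx))
  have hli := (linearIndependent_monoidHom ((ℕ → K) × (ℕ → K)) K).comp _ hinj
  rw [Fintype.linearIndependent_iff] at hli
  intro x hx
  refine hli (fun x => g x) ?_ ⟨x, hx⟩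
  ext ⟨a, c⟩
  simp only [Finset.sum_apply, Pi.smul_apply, Pi.zero_apply, Function.comp_apply, smul_eq_mul,
    expHom_apply]
  rw [Finset.sum_coe_sort S fun x => g x * (evalExp a (e x).1 * evalExp c (e x).2)]
  exact h a c

/-- A polynomial of degree `< 2q` with a double root at every point of a field with `q` elements
is zero. -/
theorem eq_zero_of_forall_double_root {p : K[X]} (hp : p.natDegree < 2 * Fintype.card K)
    (h : ∀ a, p.eval a = 0) (h' : ∀ a, (derivative p).eval a = 0) : p = 0 := by
  classical
  by_contra hp0
  have h2 : ∀ a : K, 2 ≤ p.roots.count a := fun a => by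
    rw [count_roots]
    exact (one_lt_rootMultiplicity_iff_isRoot hp0).2 ⟨h a, h' a⟩
  have h3 : ∑ a : K, 2 ≤ ∑ a : K, p.roots.count a := Finset.sum_le_sum fun a _ => h2 a
  rw [Multiset.sum_count_eq_card fun a _ => Finset.mem_univ a, Finset.sum_const, smul_eq_mul,
    Finset.card_univ] at h3
  have := p.card_roots'
  omega

end Finite

/-- The polynomial obtained from `y^k` by giving values in `K` to all variables but `y_i`. -/
def slice (a : ℕ → K) (i : ℕ) (k : ℕ →₀ ℕ) : K[X] :=
  evalExp (fun j => if j = i then X else C (a j)) k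

theorem slice_eq (a : ℕ → K) (i : ℕ) (k : ℕ →₀ ℕ) :
    slice a i k = C (evalExp a (k.erase i)) * X ^ k i := by
  classical
  rw [slice, evalExp, ← Finsupp.mul_prod_erase' k i _ (fun _ => pow_zero _), if_pos rfl, mul_comm,
    evalExp, Finsupp.prod, Finsupp.prod, map_prod]
  congr 1
  refine Finset.prod_congr rfl fun j hj => ?_
  have hji : j ≠ i := by
    rintro rfl
    simp at hj
  rw [if_neg hji, map_pow]

theorem eval_slice (a : ℕ → K) (i : ℕ) (k : ℕ →₀ ℕ) : (slice a i k).eval (a i) = evalExp a k := by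
  rw [slice, evalExp, Finsupp.prod, eval_prod, evalExp, Finsupp.prod]
  refine Finset.prod_congr rfl fun j _ => ?_
  rw [eval_pow]
  split_ifs with hj
  · rw [hj, eval_X]
  · rw [eval_C]

/-- The matrix entries as linear functionals on `UJ₂`. -/
def entry (K : Type*) [Field K] (r c : Fin 2) : UJ2 K →ₗ[K] K where
  toFun u := (SymAlg.unsym u).1 r c
  map_add' _ _ := rfl
  map_smul' _ _ := rfl

theorem entry_zero_zero (a b c : K) : entry K 0 0 (elt a b c) = a + c := rfl

theorem entry_zero_one (a b c : K) : entry K 0 1 (elt a b c) = b := rfl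

theorem entry_one_one (a b c : K) : entry K 1 1 (elt a b c) = a - c := rfl

section Values

variable [NeZero (2 : K)] {q : ℕ} (h : SatisfiesIdentities q (assEven K) (assOdd K))
include h

/-- As `e₁₂` has square zero, substituting `f_j(b) + f_j'(b) e₁₂` for `y_j` in a monomial computes
the value and the derivative at `b` of the monomial in the polynomials `f_j`. -/
theorem lmono_slice (f : ℕ → K[X]) (b : K) (k : ℕ →₀ ℕ) :
    lmono (fun j => elt ((f j).eval b) ((derivative (f j)).eval b) 0) k =
      elt ((evalExp f k).eval b) ((derivative (evalExp f k)).eval b) 0 := by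
  induction k using exponent_induction with
  | zero => rw [lmono_zero, evalExp_zero, Polynomial.eval_one, derivative_one, eval_zero, elt_one]
  | add_single k i ih =>
    rw [h.lmono_even_add_single (fun j => mem_assEven_iff.2 ⟨_, _, rfl⟩), ih, evalExp_add_single,
      elt_mul, derivative_mul, eval_add, eval_mul, eval_mul, eval_mul]
    congr 1 <;> ring

theorem lmono_elt_odd (c : ℕ → K) (s : ℕ →₀ ℕ) :
    lmono (fun j => elt 0 0 (c j)) s =
      if Even s.degree then elt (evalExp c s) 0 0 else elt 0 0 (evalExp c s) := by
  induction s using exponent_induction with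
  | zero => simp [lmono_zero, evalExp_zero, elt_one]
  | add_single s i ih =>
    rw [h.lmono_odd_add_single (fun j => mem_assOdd_iff.2 ⟨_, rfl⟩), ih, evalExp_add_single,
      map_add, Finsupp.degree_single]
    by_cases hs : Even s.degree
    · rw [if_pos hs, if_neg (by simpa [Nat.even_add_one] using hs), elt_mul]
      congr 1 <;> ring
    · rw [if_neg hs, if_pos (by simpa [Nat.even_add_one] using hs), elt_mul]
      congr 1 <;> ring

/-- The evaluation of an identity of `UJ₂` that is a combination of basis monomials: under
`y_j ↦ a_j` for `j ≠ i`, `y_i ↦ b + e₁₂` and `z_j ↦ c_j (e₁₁ - e₂₂)`. -/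
theorem sum_normalMono_eq_zero (hq : (q : K) = 0) (hq0 : q ≠ 0) {g : BasisIndex q →₀ K}
    (hg : Finsupp.linearCombination K (basisElem K) g ∈ TAss K) (a c : ℕ → K) (i : ℕ) (b : K) :
    ∑ x ∈ g.support, g x • (if Even x.exps.2.degree then
      elt ((slice a i x.exps.1).eval b * evalExp c x.exps.2)
        ((derivative (slice a i x.exps.1)).eval b * evalExp c x.exps.2) 0
      else elt 0 0 ((slice a i x.exps.1).eval b * evalExp c x.exps.2)) = 0 := by
  let f : ℕ → K[X] := fun j => if j = i then X else C (a j)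
  let Y : ℕ → UJ2 K := fun j => elt ((f j).eval b) ((derivative (f j)).eval b) 0
  let Z : ℕ → UJ2 K := fun j => elt 0 0 (c j)
  have hY : ∀ j, Y j ∈ assEven K := fun j => mem_assEven_iff.2 ⟨_, _, rfl⟩
  have hZ : ∀ j, Z j ∈ assOdd K := fun j => mem_assOdd_iff.2 ⟨_, rfl⟩
  rw [← hg Y Z hY hZ, Finsupp.linearCombination_apply, Finsupp.sum, map_sum]
  refine Finset.sum_congr rfl fun x _ => ?_
  rw [map_smul, map_basisElem h (eval Y Z) (eval_one Y Z)
    (fun j => (eval_y Y Z j).symm ▸ hY j) (fun j => (eval_z Y Z j).symm ▸ hZ j) hq hq0 x]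
  have h1 : eval Y Z ∘ y K = Y := funext fun j => eval_y Y Z j
  have h2 : eval Y Z ∘ z K = Z := funext fun j => eval_z Y Z j
  rw [h1, h2, normalMono, lmono_slice h, lmono_elt_odd h, ← slice]
  congr 1
  split_ifs
  · rw [elt_mul]
    congr 1 <;> ring
  · rw [elt_mul]
    congr 1 <;> ring

/-- The basis monomials are linearly independent modulo the identities of `UJ₂`. -/
theorem eq_zero_of_linearCombination_mem_TAss [Fintype K] (hcard : Fintype.card K = q)
    (hq : (q : K) = 0) (hq2 : 2 ≤ q) {g : BasisIndex q →₀ K}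
    (hg : Finsupp.linearCombination K (basisElem K) g ∈ TAss K) : g = 0 := by
  classical
  have hsum := sum_normalMono_eq_zero h hq (by omega) hg
  -- The coefficient of a monomial with an exponent `≥ q` at `y_i` vanishes: as a polynomial in
  -- `y_i` the even part of the combination has double roots, and its coefficients are reduced
  -- functions of the other variables.
  have hbig : ∀ x ∈ g.support, ∀ i, x.exps.1 i < q := by
    intro x₀ hx₀ i
    by_contra! hi
    let S := g.support.filter fun x => Even x.exps.2.degree
    have hcoeff : ∀ a c : ℕ → K, ∑ x ∈ S with x.exps.1 i = x₀.exps.1 i,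
        g x * (evalExp a (x.exps.1.erase i) * evalExp c x.exps.2) = 0 := by
      intro a c
      let p : K[X] := ∑ x ∈ S, C (g x * evalExp c x.exps.2) * slice a i x.exps.1
      have hp : p = 0 := by
        refine eq_zero_of_forall_double_root ?_ (fun b => ?_) fun b => ?_
        · rw [hcard]
          refine (natDegree_sum_le_of_forall_le (n := 2 * q - 1) _ _ fun x _ => ?_).trans_lt
            (by omega)
          rw [slice_eq, ← mul_assoc, ← C_mul]
          refine (natDegree_C_mul_X_pow_le _ _).trans ?_
          have := (x.exps_mem hq2).1.1 i
          omega
        · -- Half the trace reads off the coefficient of the unit element.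
          have h0 := congrArg (entry K 0 0 + entry K 1 1) (hsum a c i b)
          rw [map_zero, map_sum] at h0
          have h2 : (2 : K) * p.eval b = 0 := by
            rw [← h0, eval_finsetSum, Finset.sum_filter, Finset.mul_sum]
            refine Finset.sum_congr rfl fun x _ => ?_
            rw [map_smul]
            split_ifs
            · rw [LinearMap.add_apply, entry_zero_zero, entry_one_one, eval_mul, eval_C,
                smul_eq_mul]
              ring
            · rw [LinearMap.add_apply, entry_zero_zero, entry_one_one, smul_eq_mul]
              ring
          exact (mul_eq_zero.1 h2).resolve_left (NeZero.ne _)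
        · have h0 := congrArg (entry K 0 1) (hsum a c i b)
          rw [map_zero, map_sum] at h0
          rw [← h0, derivative_sum, eval_finsetSum, Finset.sum_filter]
          refine Finset.sum_congr rfl fun x _ => ?_
          rw [map_smul]
          split_ifs
          · rw [entry_zero_one, derivative_C_mul, eval_mul, eval_C, smul_eq_mul]
            ring
          · rw [entry_zero_one, smul_zero]
      have h0 := congrArg (fun p => p.coeff (x₀.exps.1 i)) hp
      simp only [coeff_zero, p, finsetSum_coeff, slice_eq, ← mul_assoc, ← C_mul,
        coeff_C_mul_X_pow] at h0
      rw [← h0, Finset.sum_filter]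
      refine Finset.sum_congr rfl fun x _ => ?_
      by_cases hx : x.exps.1 i = x₀.exps.1 i
      · rw [if_pos hx, if_pos hx.symm]; ring
      · rw [if_neg hx, if_neg (Ne.symm hx)]
    have hx₀S : x₀ ∈ S := by
      refine Finset.mem_filter.2 ⟨hx₀, ?_⟩
      by_contra ho
      exact absurd ((x₀.exps_mem hq2).2.2 (Nat.not_even_iff_odd.1 ho) i) (not_lt.2 hi)
    have hred : ∀ x ∈ S.filter (fun x => x.exps.1 i = x₀.exps.1 i), g x = 0 := by
      refine eq_zero_of_sum_evalExp_eq_zero (g := fun x => g x)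
        (e := fun x : BasisIndex q => (x.exps.1.erase i, x.exps.2)) ?_ ?_ ?_ hcoeff
      · intro x hx x' hx' hxx
        have hx := (Finset.mem_filter.1 hx).2
        have hx' := (Finset.mem_filter.1 hx').2
        obtain ⟨h1, h2⟩ := Prod.mk.inj hxx
        refine BasisIndex.exps_injective (Prod.ext ?_ h2)
        rw [← Finsupp.erase_add_single i x.exps.1, ← Finsupp.erase_add_single i x'.exps.1, h1, hx,
          hx']
      · intro x hx j
        have hx := (Finset.mem_filter.1 hx).2
        rw [hcard]
        by_cases hj : j = i
        · rw [hj, Finsupp.erase_same]; omega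
        · rw [Finsupp.erase_ne hj]
          exact (x.exps_mem hq2).1.2 i (hx ▸ hi) j hj
      · intro x _ j
        rw [hcard]
        exact (x.exps_mem hq2).2.1 j
    exact Finsupp.mem_support_iff.1 hx₀ (hred x₀ (Finset.mem_filter.2 ⟨hx₀S, rfl⟩))
  have hzero : ∀ x ∈ g.support, g x = 0 := by
    refine eq_zero_of_sum_evalExp_eq_zero (g := fun x => g x) (e := BasisIndex.exps)
      BasisIndex.exps_injective.injOn (fun x hx i => hcard ▸ hbig x hx i)
      (fun x _ j => hcard ▸ (x.exps_mem hq2).2.1 j) fun a c => ?_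
    have h0 := congrArg (entry K 0 0) (hsum a c 0 (a 0))
    rw [map_zero, map_sum] at h0
    rw [← h0]
    refine Finset.sum_congr rfl fun x _ => ?_
    rw [map_smul, eval_slice]
    split_ifs <;> rw [entry_zero_zero, smul_eq_mul] <;> ring
  ext x
  by_contra hx
  exact hx (hzero x (Finsupp.mem_support_iff.2 hx))

end Values

end Independence

end GradedUJ

end

theorem mainTheorem2 (K : Type*) [Field K] [Finite K] [NeZero (2 : K)]
    (q : ℕ) (hq : Nat.card K = q) :
    GradedUJ.tIdeal (GradedUJ.generators K q) = GradedUJ.TAss K ∧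
      ∃ B : Module.Basis (GradedUJ.BasisIndex q) K
          (GradedUJ.J K ⧸ GradedUJ.tIdeal (GradedUJ.generators K q)),
        ∀ x, B x =
          (GradedUJ.tIdeal (GradedUJ.generators K q)).mkQ (GradedUJ.basisElem K x) := by
  have := Fintype.ofFinite K
  rw [Nat.card_eq_fintype_card] at hq
  have hq0 : (q : K) = 0 := hq ▸ FiniteField.cast_card_eq_zero K
  have hpow : ∀ a : K, a ^ q = a := fun a => hq ▸ FiniteField.pow_card a
  have hq2 : 2 ≤ q := hq ▸ Fintype.one_lt_card
  have hodd : Odd q := by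
    rw [Nat.odd_iff, ← hq]
    refine FiniteField.odd_card_of_char_ne_two fun hchar => NeZero.ne (2 : K) ?_
    exact_mod_cast hchar ▸ ringChar.Nat.cast_ringChar (R := K)
  have h := GradedUJ.satisfiesIdentities_UJ2 hq0 hodd hpow
  have hle : GradedUJ.tIdeal (GradedUJ.generators K q) ≤ GradedUJ.TAss K :=
    sInf_le ⟨h.isTIdeal_TAss, h.generators_subset_TAss⟩
  have hspan := GradedUJ.exists_sub_mem_of_generators_subset
    (GradedUJ.isTIdeal_tIdeal (GradedUJ.generators K q)) (GradedUJ.subset_tIdeal _) hq0 hq2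
  refine ⟨le_antisymm hle fun f hf => ?_, ?_⟩
  · obtain ⟨g, hg, hfg⟩ := hspan f
    obtain ⟨l, rfl⟩ := (Finsupp.mem_span_range_iff_exists_finsupp).1 hg
    have hl : Finsupp.linearCombination K (GradedUJ.basisElem K) l ∈ GradedUJ.TAss K := by
      have := Submodule.sub_mem _ hf (hle hfg)
      rwa [sub_sub_cancel] at this
    have hl0 := GradedUJ.eq_zero_of_linearCombination_mem_TAss h hq hq0 hq2 hl
    rw [hl0, Finsupp.sum_zero_index, sub_zero] at hfg
    exact hfg
  · have hli : LinearIndependent K fun x : GradedUJ.BasisIndex q =>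
        (GradedUJ.tIdeal (GradedUJ.generators K q)).mkQ (GradedUJ.basisElem K x) := by
      rw [linearIndependent_iff]
      intro l hl
      refine GradedUJ.eq_zero_of_linearCombination_mem_TAss h hq hq0 hq2 (hle ?_)
      rw [← Submodule.Quotient.mk_eq_zero, ← Submodule.mkQ_apply,
        Finsupp.apply_linearCombination]
      exact hl
    refine ⟨Module.Basis.mk hli ?_, fun x => Module.Basis.mk_apply _ _ x⟩
    rintro f -
    obtain ⟨f, rfl⟩ := Submodule.mkQ_surjective _ f
    obtain ⟨g, hg, hfg⟩ := hspan f
    have hfg' : (GradedUJ.tIdeal (GradedUJ.generators K q)).mkQ f =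
        (GradedUJ.tIdeal (GradedUJ.generators K q)).mkQ g := (Submodule.Quotient.eq _).2 hfg
    have := Submodule.mem_map_of_mem
      (f := (GradedUJ.tIdeal (GradedUJ.generators K q)).mkQ) hg
    rw [Submodule.map_span, ← Set.range_comp] at this
    rw [hfg']
    exact this
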